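/- **Setting.** Let $\tau=(\tau_i)_{i\ge0}$ be a renewal process with law $\mathbf P$: $\tau_0=0$ and the increments $\tau_i-\tau_{i-1}$ are IID with values in $\{1,2,\dots\}$ (in particular almost surely finite, i.e. $\tau$ is recurrent), with $$\mathrm K(n):=\mathbf P(\tau_1=n)\sim \frac{c_K}{n^{1+\alpha}}\quad(n\to\infty),\qquad c_K>0,\ \alpha>0,\ \alpha\neq1 .$$ Put $\delta_n:=\mathbf 1_{\{n\in\tau\}}$. Let $\omega=(\omega_i)_{i\ge 0}$ be a stationary and ergodic $\{-1,+1\}$-valued sequence with law $\mathbb P$ such that $\mathbb P(\omega_1=+1)>0$ and $\mathbb P(\omega_1=-1)>0$. For $\beta\ge0$, $h\in\mathbb R$ let $$Z_{N,h}^{\omega,\beta}:=\mathbf E\Big[\exp\Big(\sum_{n=1}^N(h+\beta\omega_n)\delta_n\Big)\Big],\qquad F(\beta,h):=\lim_{N\to\infty}\frac1N\,\mathbb E\log Z_{N,h}^{\omega,\beta},$$ $$h_c(\beta):=\inf\{h\in\mathbb R: F(\beta,h)>0\},$$ so that $F(0,\cdot)$ is the free energy of the homogeneous model. Conditionally on $\omega_0=-1$,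 $\omega_1=+1$, set $T_0:=0$, $T_n:=\inf\{i>T_{n-1}:\omega_{i+1}\ne\omega_i\}$ and $\xi_n:=T_n-T_{n-1}$ for $n\ge1$; then $(T_{2j},T_{2j+1}]$, $j\ge0$, are the maximal intervals of $\{1,2,\dots\}$ on which $\omega\equiv+1$. Let $\mathcal T_1(A):=\inf\{T_{2j+1}: j\ge 0,\ \xi_{2j+1}\ge A\}$ (with $\inf\emptyset=+\infty$) be the position of the first such interval of length at least $A$. One has *infinite disorder* if, conditionally on $\omega_0=-1$, $\omega_1=+1$, almost surely $$\liminf_{n\to\infty}\frac1n\log\mathcal T_1(n)=0.$$ **Theorem.** Let $\beta>0$. If $h_c(\beta)=-\beta$, then $$F(\beta,-\beta+u)=o\big(F(0,u)\big)\qquad\text{as }u\downarrow0 .$$ In particular, under infinite disorder one has, for every $\beta>0$, $h_c(\beta)=-\beta$ and $F(\beta,-\beta+u)=o(F(0,u))$ as $u\downarrow0$. -/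

import Mathlib

open Filter Topology MeasureTheory ProbabilityTheory Asymptotics

noncomputable section

namespace Pinning

/-! ### The renewal process -/

/-- Law of the sequence of inter-arrival times `(τ (i+1) - τ i)`: IID with common law `K`. -/
def renewalLaw (K : PMF ℕ) : Measure (ℕ → ℕ) :=
  Measure.infinitePi (fun _ : ℕ => K.toMeasure)

/-- The renewal times `τ 0 = 0`, `τ k = x 0 + ⋯ + x (k-1)` with inter-arrival times `x`. -/
def renewalTime (x : ℕ → ℕ) (k : ℕ) : ℕ := ∑ i ∈ Finset.range k, x i

/-- `δ_n`, the indicator that `n` belongs to the renewal set `{τ 0, τ 1, …}`. -/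
def contact (x : ℕ → ℕ) (n : ℕ) : ℝ := Set.indicator (Set.range (renewalTime x)) 1 n

/-- The inter-arrival law `K` is carried by `{1, 2, …}` (it has total mass one, so the renewal is
recurrent) and satisfies `K(n) ~ cK / n ^ (1 + α)` with `α, cK > 0`. -/
structure IsInterarrivalLaw (K : PMF ℕ) (α cK : ℝ) : Prop where
  exponent_pos : 0 < α
  const_pos : 0 < cK
  apply_zero : K 0 = 0
  isEquivalent : (fun n : ℕ => (K n).toReal) ~[atTop] fun n : ℕ => cK / (n : ℝ) ^ (1 + α)

/-! ### The environment -/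

/-- The left shift on sequences. -/
def shift (ω : ℕ → ℝ) : ℕ → ℝ := fun i => ω (i + 1)

/-- `P` is the law of a stationary, ergodic, `{-1, 1}`-valued sequence `(ω_i)_{i ≥ 0}`
taking both values with positive probability. -/
structure IsBinaryEnvironment (P : Measure (ℕ → ℝ)) : Prop where
  isProbabilityMeasure : IsProbabilityMeasure P
  ergodic : Ergodic shift P
  binary : ∀ᵐ ω ∂P, ∀ i, ω i = 1 ∨ ω i = -1
  plus_pos : 0 < P {ω | ω 1 = 1}
  minus_pos : 0 < P {ω | ω 1 = -1}

/-! ### Partition function, free energy, critical point -/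

/-- The quenched partition function with free boundary condition,
`Z_N = 𝐄[exp(∑_{n=1}^N (h + β ω_n) δ_n)]`. -/
def partitionFunction (K : PMF ℕ) (β h : ℝ) (N : ℕ) (ω : ℕ → ℝ) : ℝ :=
  ∫ x, Real.exp (∑ n ∈ Finset.Icc 1 N, (h + β * ω n) * contact x n) ∂(renewalLaw K)

/-- The quenched free energy `F(β, h) = lim_N (1/N) 𝔼[log Z_N]`. The sequence is bounded and
converges for stationary environments, so that its limit is its upper limit. -/
def freeEnergy (K : PMF ℕ) (P : Measure (ℕ → ℝ)) (β h : ℝ) : ℝ :=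
  limsup (fun N : ℕ => (1 / (N : ℝ)) * ∫ ω, Real.log (partitionFunction K β h N ω) ∂P) atTop

/-- The quenched critical point `h_c(β) = inf {h | F(β, h) > 0}`, possibly infinite. -/
def criticalPoint (K : PMF ℕ) (P : Measure (ℕ → ℝ)) (β : ℝ) : EReal :=
  ⨅ (h : ℝ) (_ : 0 < freeEnergy K P β h), (h : EReal)

/-! ### Attractive regions and infinite disorder -/

/-- `T 0 = 0` and `T (n+1) = inf {i > T n | ω_{i+1} ≠ ω_i}`: the environment is constant on each
block `(T n, T (n+1)]`, with alternating values. -/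
def blockEnd (ω : ℕ → ℝ) : ℕ → ℕ∞
  | 0 => 0
  | n + 1 => ⨅ (i : ℕ) (_ : blockEnd ω n < (i : ℕ∞) ∧ ω (i + 1) ≠ ω i), (i : ℕ∞)

/-- The length `T (n+1) - T n` of the block number `n + 1` (written `ξ_{n+1}`). -/
def blockLength (ω : ℕ → ℝ) (n : ℕ) : ℕ∞ := blockEnd ω (n + 1) - blockEnd ω n

/-- `𝒯_1(A) = inf {T (2i+1) | ξ_{2i+1} ≥ A}`: the position of the first block with odd index and
length at least `A`. When `ω_0 = -1` and `ω_1 = 1`, the blocks with odd index are the attractive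
ones. -/
def firstBlock (ω : ℕ → ℝ) (A : ℕ) : ℕ∞ :=
  ⨅ (i : ℕ) (_ : (A : ℕ∞) ≤ blockLength ω (2 * i)), blockEnd ω (2 * i + 1)

/-- Infinite disorder: `liminf_n (1/n) log 𝒯_1(n) = 0` almost surely, the environment being
conditioned to start with `ω_0 = -1`, `ω_1 = 1`. -/
def InfiniteDisorder (P : Measure (ℕ → ℝ)) : Prop :=
  ∀ᵐ ω ∂(cond P {ω | ω 0 = -1 ∧ ω 1 = 1}),
    liminf (fun n : ℕ => ENNReal.log (firstBlock ω n : ENNReal) / ((n : ℝ) : EReal)) atTop = 0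

end Pinning

end

noncomputable section

namespace Pinning

/-! ### First-step decomposition of the partition function -/

/-! Conditioning on the first renewal gives a recursion for the partition function
(`siteZ_eq_tsum`). Exponential supersolutions bound it from above (`siteZ_le_of_supersolution`), and
subsolutions along attractive stretches bound it from below (`siteZ_ge_of_constant_stretch`).

At `h = -β + u` an attractive site pays `u` and a repulsive one pays `u - 2β`. Choose a block length
`l` with `u` at most a small multiple of `l ^ (-α)`. If the block two steps ahead has a positive
density of repulsive sites, the next renewal hits one of them with probability at least of order `l
^ (-α)`. That loss absorbs the gain `u`, so nothing grows (`tsum_exp_le_one_of_notMem_sparse`).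
Growth is charged only where the block ahead is sparse in repulsive sites, and by the mean ergodic
theorem this has probability tending to zero as `l → ∞`. Growth there is at most 1 per length `l` or
`u` per site. For `α < 1` this gives the bound `P(sparse) / l` with `l` of order `u ^ (-1/α)`. For
`α > 1` it gives `u * P(sparse)` with `l` fixed but arbitrarily large (`freeEnergy_le_sparse`). Both
are negligible against the lower bound of order `u ^ max 1 (1/α)` for the homogeneous free energy
(`exists_le_freeEnergy_zero`).

Under infinite disorder, Borel-Cantelli shows that attractive runs of length `n` have probability at
least `exp (-ε n)` for infinitely many `n` (`frequently_attractiveRun`). A renewal that visits such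
runs and jumps from one to the next gains about `lam * n` per run, where `lam > 0` is a homogeneous
growth rate at `u`, and pays about `(1 + α) * ε * n` per jump. For small `ε` the free energy is
positive for all small `u > 0` (`freeEnergy_pos`), which identifies the critical point. -/

/-- The partition function with general site energies `w`. -/
def siteZ (K : PMF ℕ) (w : ℕ → ℝ) (N : ℕ) : ℝ :=
  ∫ x, Real.exp (∑ n ∈ Finset.Icc 1 N, w n * contact x n) ∂(renewalLaw K)

/-- The sequence with first term `n` followed by `x`. -/
def prepend (n : ℕ) (x : ℕ → ℕ) : ℕ → ℕ
  | 0 => n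
  | i + 1 => x i

instance isProbabilityMeasure_renewalLaw (K : PMF ℕ) : IsProbabilityMeasure (renewalLaw K) := by
  unfold renewalLaw; infer_instance

theorem measurable_renewalTime (k : ℕ) : Measurable fun x : ℕ → ℕ => renewalTime x k := by
  unfold renewalTime; fun_prop

theorem measurable_contact (n : ℕ) : Measurable fun x : ℕ → ℕ => contact x n := by
  have h : (fun x : ℕ → ℕ => contact x n) =
      Set.indicator (⋃ k, (fun x : ℕ → ℕ => renewalTime x k) ⁻¹' {n}) 1 := by
    ext x
    by_cases hx : n ∈ Set.range (renewalTime x)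
    · rw [contact, Set.indicator_of_mem hx, Set.indicator_of_mem (by simpa using hx)]; simp
    · rw [contact, Set.indicator_of_notMem hx, Set.indicator_of_notMem (by simpa using hx)]
  rw [h]
  exact measurable_one.indicator
    (MeasurableSet.iUnion fun k => measurable_renewalTime k (measurableSet_singleton n))

theorem contact_nonneg (x : ℕ → ℕ) (n : ℕ) : 0 ≤ contact x n :=
  Set.indicator_nonneg (fun _ _ => zero_le_one) _

theorem contact_le_one (x : ℕ → ℕ) (n : ℕ) : contact x n ≤ 1 :=
  Set.indicator_le_self' (fun _ _ => zero_le_one) _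

theorem measurable_energy (w : ℕ → ℝ) (N : ℕ) :
    Measurable fun x : ℕ → ℕ => ∑ n ∈ Finset.Icc 1 N, w n * contact x n :=
  Finset.measurable_sum _ fun n _ => (measurable_contact n).const_mul _

theorem measurable_prepend : Measurable fun p : ℕ × (ℕ → ℕ) => prepend p.1 p.2 := by
  refine measurable_pi_lambda _ fun i => ?_
  cases i with
  | zero => exact measurable_fst
  | succ i => exact (measurable_pi_apply i).comp measurable_snd

/-- Product measures are determined by cylinders, and a cylinder splits into a condition on
coordinate 0 and one on the shifted coordinates. -/
theorem map_prepend_renewalLaw (K : PMF ℕ) :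
    (K.toMeasure.prod (renewalLaw K)).map (fun p => prepend p.1 p.2) = renewalLaw K := by
  refine Measure.eq_infinitePi _ fun s t ht => ?_
  have hs : MeasurableSet (Set.pi (s : Set ℕ) t) :=
    MeasurableSet.pi s.countable_toSet fun i _ => ht i
  classical
  have key : (fun p : ℕ × (ℕ → ℕ) => prepend p.1 p.2) ⁻¹' (Set.pi (s : Set ℕ) t) =
      (if 0 ∈ s then t 0 else Set.univ) ×ˢ
        Set.pi ((s.erase 0).image Nat.pred : Finset ℕ) (fun i => t (i + 1)) := by
    ext ⟨n, x⟩
    simp only [Set.mem_preimage, Set.mem_pi, Finset.mem_coe, Set.mem_prod, Finset.mem_image,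
      Finset.mem_erase]
    constructor
    · intro h
      refine ⟨?_, ?_⟩
      · split_ifs with h0
        · exact h 0 h0
        · trivial
      · rintro i ⟨a, ⟨ha, has⟩, rfl⟩
        obtain ⟨b, rfl⟩ := Nat.exists_eq_succ_of_ne_zero ha
        exact h _ has
    · rintro ⟨h0, h1⟩ i hi
      cases i with
      | zero => rw [if_pos hi] at h0; exact h0
      | succ i => exact h1 i ⟨i + 1, ⟨by omega, hi⟩, rfl⟩
  rw [Measure.map_apply measurable_prepend hs, key, Measure.prod_prod, renewalLaw,
    Measure.infinitePi_pi _ (fun i _ => ht (i + 1)), Finset.prod_image]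
  · have h2 : ∀ i ∈ s.erase 0, K.toMeasure (t (i.pred + 1)) = K.toMeasure (t i) := by
      intro i hi
      rw [← Nat.succ_eq_add_one,
        Nat.succ_pred_eq_of_pos (Nat.pos_of_ne_zero (Finset.mem_erase.1 hi).1)]
    rw [Finset.prod_congr rfl h2]
    split_ifs with h0
    · exact Finset.mul_prod_erase s (fun i => K.toMeasure (t i)) h0
    · rw [measure_univ, one_mul, Finset.erase_eq_of_notMem h0]
  · intro a ha b hb hab
    have h1 := (Finset.mem_erase.1 ha).1
    have h2 := (Finset.mem_erase.1 hb).1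
    simp only [Nat.pred_eq_sub_one] at hab
    omega

theorem renewalTime_prepend_succ (n : ℕ) (x : ℕ → ℕ) (k : ℕ) :
    renewalTime (prepend n x) (k + 1) = n + renewalTime x k := by
  simp [renewalTime, Finset.sum_range_succ', prepend, add_comm]

theorem contact_prepend_add (n : ℕ) (hn : 1 ≤ n) (x : ℕ → ℕ) (m : ℕ) :
    contact (prepend n x) (n + m) = contact x m := by
  have : (n + m ∈ Set.range (renewalTime (prepend n x))) ↔ m ∈ Set.range (renewalTime x) := by
    constructor
    · rintro ⟨k, hk⟩
      cases k with
      | zero => simp [renewalTime] at hk; omega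
      | succ k => rw [renewalTime_prepend_succ] at hk; exact ⟨k, by omega⟩
    · rintro ⟨k, hk⟩
      exact ⟨k + 1, by rw [renewalTime_prepend_succ, hk]⟩
  by_cases hx : m ∈ Set.range (renewalTime x)
  · rw [contact, contact, Set.indicator_of_mem hx, Set.indicator_of_mem (this.2 hx)]; simp
  · rw [contact, contact, Set.indicator_of_notMem hx, Set.indicator_of_notMem (mt this.1 hx)]

theorem contact_prepend_lt (n : ℕ) (x : ℕ → ℕ) (m : ℕ) (hm : 1 ≤ m) (hmn : m < n) :
    contact (prepend n x) m = 0 := by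
  refine Set.indicator_of_notMem ?_ _
  rintro ⟨k, hk⟩
  cases k with
  | zero => simp [renewalTime] at hk; omega
  | succ k => rw [renewalTime_prepend_succ] at hk; omega

theorem contact_zero (x : ℕ → ℕ) : contact x 0 = 1 :=
  Set.indicator_of_mem (Set.mem_range.2 ⟨0, by simp [renewalTime]⟩) _

theorem energy_prepend (w : ℕ → ℝ) (N n : ℕ) (hn : 1 ≤ n) (x : ℕ → ℕ) :
    ∑ m ∈ Finset.Icc 1 N, w m * contact (prepend n x) m =
      if n ≤ N then w n + ∑ m ∈ Finset.Icc 1 (N - n), w (n + m) * contact x m else 0 := by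
  split_ifs with h
  · have h1 : ∑ m ∈ Finset.Icc 1 N, w m * contact (prepend n x) m =
        ∑ m ∈ Finset.Icc n N, w m * contact (prepend n x) m := by
      refine (Finset.sum_subset (Finset.Icc_subset_Icc_left hn) fun m hm hm' => ?_).symm
      rw [Finset.mem_Icc] at hm hm'
      rw [contact_prepend_lt n x m hm.1 (by omega), mul_zero]
    have h2 : Finset.Icc n N = (Finset.Icc 0 (N - n)).map (addLeftEmbedding n) := by
      rw [Finset.map_add_left_Icc]; congr 1; omega
    have h3 : Finset.Icc 0 (N - n) = insert 0 (Finset.Icc 1 (N - n)) := by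
      ext m; simp only [Finset.mem_insert, Finset.mem_Icc]; omega
    rw [h1, h2, Finset.sum_map]
    simp only [addLeftEmbedding_apply, contact_prepend_add n hn]
    rw [h3, Finset.sum_insert (by simp)]
    simp [contact_zero]
  · refine Finset.sum_eq_zero fun m hm => ?_
    rw [Finset.mem_Icc] at hm
    rw [contact_prepend_lt n x m hm.1 (by omega), mul_zero]

theorem abs_energy_le {w : ℕ → ℝ} {N : ℕ} {C : ℝ} (hw : ∀ n ∈ Finset.Icc 1 N, |w n| ≤ C)
    (x : ℕ → ℕ) : |∑ n ∈ Finset.Icc 1 N, w n * contact x n| ≤ N * C := by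
  refine (Finset.abs_sum_le_sum_abs _ _).trans ?_
  refine (Finset.sum_le_card_nsmul _ _ C fun n hn => ?_).trans (by simp)
  rw [abs_mul, abs_of_nonneg (contact_nonneg x n)]
  exact (mul_le_of_le_one_right (abs_nonneg _) (contact_le_one x n)).trans (hw n hn)

theorem exists_abs_le (w : ℕ → ℝ) (N : ℕ) : ∃ C, ∀ n ∈ Finset.Icc 1 N, |w n| ≤ C := by
  refine ⟨∑ n ∈ Finset.Icc 1 N, |w n|, fun n hn => ?_⟩
  exact Finset.single_le_sum (f := fun n => |w n|) (fun _ _ => abs_nonneg _) hn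

theorem integrable_boltzmann (K : PMF ℕ) (w : ℕ → ℝ) (N : ℕ) :
    Integrable (fun x => Real.exp (∑ n ∈ Finset.Icc 1 N, w n * contact x n)) (renewalLaw K) := by
  obtain ⟨C, hC⟩ := exists_abs_le w N
  refine Integrable.of_bound ((measurable_energy w N).exp.aestronglyMeasurable)
    (Real.exp (N * C)) (ae_of_all _ fun x => ?_)
  rw [Real.norm_eq_abs, Real.abs_exp]
  exact Real.exp_le_exp.2 ((le_abs_self _).trans (abs_energy_le hC x))

theorem siteZ_le_exp (K : PMF ℕ) {w : ℕ → ℝ} {N : ℕ} {C : ℝ}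
    (hw : ∀ n ∈ Finset.Icc 1 N, |w n| ≤ C) : siteZ K w N ≤ Real.exp (N * C) := by
  have := integral_mono (integrable_boltzmann K w N) (integrable_const (Real.exp (N * C)))
    (fun x => Real.exp_le_exp.2 ((le_abs_self _).trans (abs_energy_le hw x)))
  simpa [siteZ] using this

theorem exp_neg_le_siteZ (K : PMF ℕ) {w : ℕ → ℝ} {N : ℕ} {C : ℝ}
    (hw : ∀ n ∈ Finset.Icc 1 N, |w n| ≤ C) : Real.exp (-(N * C)) ≤ siteZ K w N := by
  have := integral_mono (integrable_const (Real.exp (-(N * C)))) (integrable_boltzmann K w N)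
    (fun x => Real.exp_le_exp.2 (neg_le_of_abs_le (abs_energy_le hw x)))
  simpa [siteZ] using this

theorem siteZ_pos (K : PMF ℕ) (w : ℕ → ℝ) (N : ℕ) : 0 < siteZ K w N := by
  obtain ⟨C, hC⟩ := exists_abs_le w N
  exact (Real.exp_pos _).trans_le (exp_neg_le_siteZ K hC)

theorem siteZ_le_one (K : PMF ℕ) {w : ℕ → ℝ} {N : ℕ} (hw : ∀ n ∈ Finset.Icc 1 N, w n ≤ 0) :
    siteZ K w N ≤ 1 := by
  have := integral_mono (integrable_boltzmann K w N) (integrable_const (1 : ℝ)) (fun x => by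
    refine Real.exp_le_one_iff.2 (Finset.sum_nonpos fun n hn => ?_)
    exact mul_nonpos_of_nonpos_of_nonneg (hw n hn) (contact_nonneg x n))
  simpa [siteZ] using this

/-- Renewal property at the first renewal time. A first jump past `N` meets no site, hence the value
1. The term `n = 0` would be circular but carries no mass. -/
theorem siteZ_eq_tsum (K : PMF ℕ) (hK : K 0 = 0) (w : ℕ → ℝ) (N : ℕ) :
    siteZ K w N = ∑' n, (K n).toReal *
      (if n ≤ N then Real.exp (w n) * siteZ K (fun m => w (n + m)) (N - n) else 1) := by
  have hint := integrable_boltzmann K w N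
  have hpos : ∀ᵐ n ∂K.toMeasure, 1 ≤ n := by
    rw [ae_iff]
    have : {a : ℕ | ¬ 1 ≤ a} = {0} := by ext a; simp
    rw [this, PMF.toMeasure_apply_singleton _ _ (measurableSet_singleton 0), hK]
  set G : ℕ → ℝ := fun n =>
    if n ≤ N then Real.exp (w n) * siteZ K (fun m => w (n + m)) (N - n) else 1 with hG
  have h1 : siteZ K w N = ∫ n, ∫ x, Real.exp (∑ m ∈ Finset.Icc 1 N,
      w m * contact (prepend n x) m) ∂(renewalLaw K) ∂K.toMeasure := by
    unfold siteZ
    conv_lhs => rw [← map_prepend_renewalLaw K]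
    rw [integral_map measurable_prepend.aemeasurable
      (measurable_energy w N).exp.aestronglyMeasurable, integral_prod]
    rw [← map_prepend_renewalLaw K] at hint
    exact hint.comp_measurable measurable_prepend
  have h2 : siteZ K w N = ∫ n, G n ∂K.toMeasure := by
    rw [h1]
    refine integral_congr_ae (hpos.mono fun n hn => ?_)
    simp only [energy_prepend w N n hn, hG]
    split_ifs with h
    · simp only [Real.exp_add, integral_const_mul]
      rfl
    · simp
  -- Beyond `N` the function is constantly 1, so finitely many values have to be bounded.
  have hGb : ∀ n, |G n| ≤ 1 + ∑ k ∈ Finset.range (N + 1), |G k| := by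
    intro n
    by_cases h : n ≤ N
    · have := Finset.single_le_sum (f := fun n => |G n|) (fun _ _ => abs_nonneg _)
        (Finset.mem_range.2 (Nat.lt_succ_of_le h))
      linarith
    · have : G n = 1 := by simp [hG, h]
      rw [this, abs_one]
      linarith [Finset.sum_nonneg (s := Finset.range (N + 1)) fun k _ => abs_nonneg (G k)]
  rw [h2, PMF.integral_eq_tsum]
  · rfl
  · exact Integrable.of_bound (measurable_of_countable G).aestronglyMeasurable _
      (ae_of_all _ hGb)

/-! ### Sums against the inter-arrival law -/

theorem hasSum_toReal (K : PMF ℕ) : HasSum (fun n => (K n).toReal) 1 := by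
  have h := ENNReal.hasSum_toReal (f := fun n => K n) (by rw [K.tsum_coe]; simp)
  rwa [← ENNReal.tsum_toReal_eq (fun n => K.apply_ne_top n), K.tsum_coe, ENNReal.toReal_one] at h

theorem summable_toReal_mul (K : PMF ℕ) {g : ℕ → ℝ} {C : ℝ} (hg : ∀ n, |g n| ≤ C) :
    Summable fun n => (K n).toReal * g n := by
  refine Summable.of_norm_bounded ((hasSum_toReal K).summable.mul_right C) fun n => ?_
  rw [Real.norm_eq_abs, abs_mul, abs_of_nonneg ENNReal.toReal_nonneg]
  exact mul_le_mul_of_nonneg_left (hg n) ENNReal.toReal_nonneg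

theorem summable_siteZ (K : PMF ℕ) (w : ℕ → ℝ) (N : ℕ) :
    Summable fun n => (K n).toReal *
      (if n ≤ N then Real.exp (w n) * siteZ K (fun m => w (n + m)) (N - n) else 1) := by
  set G : ℕ → ℝ := fun n =>
    if n ≤ N then Real.exp (w n) * siteZ K (fun m => w (n + m)) (N - n) else 1 with hG
  refine summable_toReal_mul K (g := G) (C := 1 + ∑ k ∈ Finset.range (N + 1), |G k|) fun n => ?_
  by_cases h : n ≤ N
  · have := Finset.single_le_sum (f := fun n => |G n|) (fun _ _ => abs_nonneg _)
      (Finset.mem_range.2 (Nat.lt_succ_of_le h))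
    linarith
  · have : G n = 1 := by simp [hG, h]
    rw [this, abs_one]
    linarith [Finset.sum_nonneg (s := Finset.range (N + 1)) fun k _ => abs_nonneg (G k)]

theorem siteZ_term_nonneg (K : PMF ℕ) (w : ℕ → ℝ) (N n : ℕ) :
    0 ≤ (K n).toReal *
      (if n ≤ N then Real.exp (w n) * siteZ K (fun m => w (n + m)) (N - n) else 1) := by
  refine mul_nonneg ENNReal.toReal_nonneg ?_
  split_ifs
  · exact mul_nonneg (Real.exp_nonneg _) (siteZ_pos K _ _).le
  · exact zero_le_one

theorem sum_le_siteZ (K : PMF ℕ) (hK : K 0 = 0) (w : ℕ → ℝ) (N : ℕ) (s : Finset ℕ) :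
    ∑ n ∈ s, (K n).toReal *
      (if n ≤ N then Real.exp (w n) * siteZ K (fun m => w (n + m)) (N - n) else 1) ≤
      siteZ K w N := by
  rw [siteZ_eq_tsum K hK w N]
  exact (summable_siteZ K w N).sum_le_tsum _ fun n _ => siteZ_term_nonneg K w N n

theorem jump_le_siteZ (K : PMF ℕ) (hK : K 0 = 0) (w : ℕ → ℝ) {N n : ℕ} (hn : n ≤ N) :
    (K n).toReal * (Real.exp (w n) * siteZ K (fun m => w (n + m)) (N - n)) ≤ siteZ K w N := by
  have := sum_le_siteZ K hK w N {n}
  rwa [Finset.sum_singleton, if_pos hn] at this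

theorem exit_le_siteZ (K : PMF ℕ) (hK : K 0 = 0) (w : ℕ → ℝ) {N n : ℕ} (hn : N < n) :
    (K n).toReal ≤ siteZ K w N := by
  have := sum_le_siteZ K hK w N {n}
  rwa [Finset.sum_singleton, if_neg hn.not_ge, mul_one] at this

/-! ### Supersolutions and subsolutions of the renewal equation -/

/-- Induction on the remaining length, started from any `x`: the hypothesis says that one jump does
not increase `exp (b + S - V)` on average. The constants `b` and `S` make the full series dominate
the exit terms too, where the true weight is 1 and not `exp (w (x + n))`. -/
theorem siteZ_le_of_supersolution (K : PMF ℕ) (hK : K 0 = 0) {w V : ℕ → ℝ} {b u S : ℝ} {N : ℕ}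
    (hb : ∀ n, -b ≤ w n) (hu : ∀ n, w n ≤ u) (hV : Monotone V) (hS : ∀ n, V n ≤ S)
    (h : ∀ x ≤ N, ∑' n, (K n).toReal * Real.exp (w (x + n) - (V (x + n) - V x)) ≤ 1) :
    siteZ K w N ≤ Real.exp (b + S - V 0) := by
  suffices H : ∀ r x, x + r = N →
      siteZ K (fun m => w (x + m)) r ≤ Real.exp (b + S - V x) by
    simpa using H N 0 (zero_add N)
  intro r
  induction r using Nat.strong_induction_on with
  | _ r ih =>
    intro x hx
    have hsum : Summable fun n =>
        (K n).toReal * Real.exp (w (x + n) - (V (x + n) - V x)) := by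
      refine summable_toReal_mul K (C := Real.exp u) fun n => ?_
      rw [Real.abs_exp]
      refine Real.exp_le_exp.2 ?_
      linarith [hu (x + n), hV (Nat.le_add_right x n)]
    rw [siteZ_eq_tsum K hK]
    calc _ ≤ ∑' n, (K n).toReal * Real.exp (w (x + n) - (V (x + n) - V x)) *
          Real.exp (b + S - V x) := by
          refine (summable_siteZ K _ r).tsum_le_tsum (fun n => ?_) (hsum.mul_right _)
          rcases Nat.eq_zero_or_pos n with rfl | hn
          · simp [hK]
          rw [mul_assoc, ← Real.exp_add]
          refine mul_le_mul_of_nonneg_left ?_ ENNReal.toReal_nonneg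
          split_ifs with hnr
          · have := ih (r - n) (by omega) (x + n) (by omega)
            simp only [add_assoc] at this
            refine (mul_le_mul_of_nonneg_left this (Real.exp_nonneg _)).trans ?_
            rw [← Real.exp_add]
            refine Real.exp_le_exp.2 ?_
            linarith
          · refine Real.one_le_exp ?_
            linarith [hb (x + n), hS (x + n)]
      _ = (∑' n, (K n).toReal * Real.exp (w (x + n) - (V (x + n) - V x))) *
          Real.exp (b + S - V x) := tsum_mul_right
      _ ≤ 1 * Real.exp (b + S - V x) :=
          mul_le_mul_of_nonneg_right (h x (by omega)) (Real.exp_nonneg _)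
      _ = _ := one_mul _

/-- Restricting to jumps of length at most `R` keeps the path inside the stretch until at most `R`
sites of it remain; those are given up. The factor `q` stands for whatever follows the stretch. -/
theorem siteZ_ge_of_constant_stretch (K : PMF ℕ) (hK : K 0 = 0) {u lam q : ℝ} {R : ℕ}
    (hlam : 0 ≤ lam) (hq : 0 ≤ q)
    (h : Real.exp (-u) ≤ ∑ n ∈ Finset.range (R + 1), (K n).toReal * Real.exp (-(lam * n)))
    (r N : ℕ) (hrN : r ≤ N) (w : ℕ → ℝ) (hw : ∀ n, 1 ≤ n → n ≤ r → w n = u)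
    (hZ : ∀ y ≤ r, q ≤ siteZ K (fun m => w (y + m)) (N - y)) :
    q * Real.exp (lam * (r - R)) ≤ siteZ K w N := by
  induction r using Nat.strong_induction_on generalizing N w with
  | _ r ih =>
    rcases le_or_gt r R with hrR | hRr
    · have h0 := hZ 0 (Nat.zero_le r)
      simp only [zero_add, Nat.sub_zero] at h0
      refine (mul_le_of_le_one_right hq (Real.exp_le_one_iff.2 ?_)).trans h0
      have : (r : ℝ) ≤ R := by exact_mod_cast hrR
      exact mul_nonpos_of_nonneg_of_nonpos hlam (by linarith)
    · have hone : 1 ≤ Real.exp u *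
          ∑ n ∈ Finset.range (R + 1), (K n).toReal * Real.exp (-(lam * n)) := by
        have := mul_le_mul_of_nonneg_left h (Real.exp_nonneg u)
        rwa [← Real.exp_add, add_neg_cancel, Real.exp_zero] at this
      refine le_trans ?_ (sum_le_siteZ K hK w N (Finset.range (R + 1)))
      calc q * Real.exp (lam * (r - R))
          ≤ q * Real.exp (lam * (r - R)) * (Real.exp u *
            ∑ n ∈ Finset.range (R + 1), (K n).toReal * Real.exp (-(lam * n))) :=
            le_mul_of_one_le_right (mul_nonneg hq (Real.exp_nonneg _)) hone
        _ = ∑ n ∈ Finset.range (R + 1), (K n).toReal * (Real.exp u *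
            (q * (Real.exp (lam * (r - R)) * Real.exp (-(lam * n))))) := by
            rw [Finset.mul_sum, Finset.mul_sum]
            refine Finset.sum_congr rfl fun n _ => ?_
            ring
        _ ≤ _ := by
            refine Finset.sum_le_sum fun n hn => ?_
            rcases Nat.eq_zero_or_pos n with rfl | hn0
            · simp [hK]
            have hnR : n ≤ R := Nat.lt_succ_iff.1 (Finset.mem_range.1 hn)
            rw [if_pos (by omega), hw n hn0 (by omega)]
            refine mul_le_mul_of_nonneg_left ?_ ENNReal.toReal_nonneg
            refine mul_le_mul_of_nonneg_left ?_ (Real.exp_nonneg _)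
            have := ih (r - n) (by omega) (N - n) (by omega) (fun m => w (n + m))
              (fun m hm1 hm2 => hw _ (by omega) (by omega)) (fun y hy => by
                have := hZ (n + y) (by omega)
                simpa only [add_assoc, Nat.sub_sub] using this)
            refine le_trans (le_of_eq ?_) this
            rw [← Real.exp_add, Nat.cast_sub (by omega)]
            congr 2
            ring

/-! ### Bounds on the inter-arrival law -/

theorem IsInterarrivalLaw.exists_lower {K : PMF ℕ} {α cK : ℝ} (hK : IsInterarrivalLaw K α cK) :
    ∃ c > 0, ∃ n₀ : ℕ, 1 ≤ n₀ ∧ ∀ n : ℕ, n₀ ≤ n → c * (n : ℝ) ^ (-(1 + α)) ≤ (K n).toReal := by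
  obtain ⟨C, hC, h⟩ := hK.isEquivalent.symm.isBigO.exists_pos
  rw [IsBigOWith, eventually_atTop] at h
  obtain ⟨n₀, hn₀⟩ := h
  refine ⟨cK / C, div_pos hK.const_pos hC, n₀ + 1, by omega, fun n hn => ?_⟩
  have h1 := hn₀ n (by omega)
  have hn0 : (0 : ℝ) < n := by exact_mod_cast (by omega : 0 < n)
  rw [Real.norm_of_nonneg (div_nonneg hK.const_pos.le (Real.rpow_nonneg hn0.le _)),
    Real.norm_of_nonneg ENNReal.toReal_nonneg] at h1
  rw [Real.rpow_neg hn0.le, div_mul_eq_mul_div, div_le_iff₀ hC, ← div_eq_mul_inv]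
  linarith

theorem IsInterarrivalLaw.exists_upper {K : PMF ℕ} {α cK : ℝ} (hK : IsInterarrivalLaw K α cK) :
    ∃ C > 0, ∀ n : ℕ, 1 ≤ n → (K n).toReal ≤ C * (n : ℝ) ^ (-(1 + α)) := by
  obtain ⟨C, hC, h⟩ := hK.isEquivalent.isBigO.exists_pos
  rw [IsBigOWith, eventually_atTop] at h
  obtain ⟨n₀, hn₀⟩ := h
  refine ⟨C * cK + (n₀ : ℝ) ^ (1 + α), by have := hK.const_pos; positivity, fun n hn => ?_⟩
  have hn0 : (0 : ℝ) < n := by exact_mod_cast (by omega : 0 < n)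
  have hpos := Real.rpow_pos_of_pos hn0 (1 + α)
  have hα := hK.exponent_pos
  have hc := hK.const_pos
  rw [Real.rpow_neg hn0.le, ← div_eq_mul_inv, le_div_iff₀ hpos]
  rcases le_or_gt n₀ n with h1 | h1
  · have h2 := hn₀ n h1
    rw [Real.norm_of_nonneg (div_nonneg hc.le hpos.le),
      Real.norm_of_nonneg ENNReal.toReal_nonneg, ← mul_div_assoc, le_div_iff₀ hpos] at h2
    have : 0 ≤ (n₀ : ℝ) ^ (1 + α) := by positivity
    linarith
  · have h2 : (n : ℝ) ^ (1 + α) ≤ (n₀ : ℝ) ^ (1 + α) :=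
      Real.rpow_le_rpow hn0.le (by exact_mod_cast h1.le) (by linarith)
    have h3 : (K n).toReal ≤ 1 := by
      have := ENNReal.toReal_mono ENNReal.one_ne_top (K.coe_le_one n)
      simpa using this
    have : (K n).toReal * (n : ℝ) ^ (1 + α) ≤ 1 * (n : ℝ) ^ (1 + α) :=
      mul_le_mul_of_nonneg_right h3 hpos.le
    have : 0 < C * cK := by positivity
    linarith

/-! ### The quenched free energy -/

theorem one_le_siteZ (K : PMF ℕ) {w : ℕ → ℝ} {N : ℕ} (hw : ∀ n ∈ Finset.Icc 1 N, 0 ≤ w n) :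
    1 ≤ siteZ K w N := by
  have := integral_mono (integrable_const (1 : ℝ)) (integrable_boltzmann K w N) (fun x =>
    Real.one_le_exp (Finset.sum_nonneg fun n hn => mul_nonneg (hw n hn) (contact_nonneg x n)))
  simpa [siteZ] using this

theorem partitionFunction_eq_siteZ (K : PMF ℕ) (β h : ℝ) (N : ℕ) (ω : ℕ → ℝ) :
    partitionFunction K β h N ω = siteZ K (fun n => h + β * ω n) N := rfl

theorem partitionFunction_pos (K : PMF ℕ) (β h : ℝ) (N : ℕ) (ω : ℕ → ℝ) :
    0 < partitionFunction K β h N ω := siteZ_pos K _ N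

theorem measurable_partitionFunction (K : PMF ℕ) (β h : ℝ) (N : ℕ) :
    Measurable fun ω : ℕ → ℝ => partitionFunction K β h N ω := by
  have : StronglyMeasurable fun p : (ℕ → ℝ) × (ℕ → ℕ) =>
      Real.exp (∑ n ∈ Finset.Icc 1 N, (h + β * p.1 n) * contact p.2 n) := by
    refine Measurable.stronglyMeasurable (Measurable.exp (Finset.measurable_sum _ fun n _ => ?_))
    refine Measurable.mul ?_ ((measurable_contact n).comp measurable_snd)
    have hm : Measurable fun p : (ℕ → ℝ) × (ℕ → ℕ) => p.1 n :=
      (measurable_pi_apply n).comp measurable_fst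
    exact measurable_const.add (hm.const_mul β)
  exact this.integral_prod_right'.measurable

theorem abs_site_le {ω : ℕ → ℝ} (hω : ∀ i, ω i = 1 ∨ ω i = -1) (β h : ℝ) (n : ℕ) :
    |h + β * ω n| ≤ |h| + |β| := by
  refine (abs_add_le _ _).trans ?_
  rw [abs_mul]
  rcases hω n with h1 | h1 <;> simp [h1]

theorem abs_log_partitionFunction_le (K : PMF ℕ) (β h : ℝ) (N : ℕ) {ω : ℕ → ℝ}
    (hω : ∀ i, ω i = 1 ∨ ω i = -1) :
    |Real.log (partitionFunction K β h N ω)| ≤ N * (|h| + |β|) := by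
  have hw : ∀ n ∈ Finset.Icc 1 N, |h + β * ω n| ≤ |h| + |β| := fun n _ => abs_site_le hω β h n
  have hpos := partitionFunction_pos K β h N ω
  rw [abs_le]
  constructor
  · rw [Real.le_log_iff_exp_le hpos]
    exact exp_neg_le_siteZ K hw
  · rw [Real.log_le_iff_le_exp hpos]
    exact siteZ_le_exp K hw

section Environment

variable {P : Measure (ℕ → ℝ)}

theorem IsBinaryEnvironment.integrable_log (hP : IsBinaryEnvironment P) (K : PMF ℕ) (β h : ℝ)
    (N : ℕ) : Integrable (fun ω => Real.log (partitionFunction K β h N ω)) P := by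
  have := hP.isProbabilityMeasure
  exact Integrable.of_bound (measurable_partitionFunction K β h N).log.aestronglyMeasurable
    (N * (|h| + |β|)) (hP.binary.mono fun ω hω => abs_log_partitionFunction_le K β h N hω)

theorem IsBinaryEnvironment.abs_mean_log_le (hP : IsBinaryEnvironment P) (K : PMF ℕ) (β h : ℝ)
    (N : ℕ) :
    |(1 / (N : ℝ)) * ∫ ω, Real.log (partitionFunction K β h N ω) ∂P| ≤ |h| + |β| := by
  have := hP.isProbabilityMeasure
  have h1 := norm_integral_le_of_norm_le_const (μ := P)
    (f := fun ω => Real.log (partitionFunction K β h N ω)) (C := N * (|h| + |β|))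
    (hP.binary.mono fun ω hω => abs_log_partitionFunction_le K β h N hω)
  simp only [probReal_univ, mul_one, Real.norm_eq_abs] at h1
  rw [abs_mul, abs_of_nonneg (by positivity)]
  rcases Nat.eq_zero_or_pos N with rfl | hN
  · simp; positivity
  · have hN' : (0 : ℝ) < N := by exact_mod_cast hN
    rw [div_mul_eq_mul_div, one_mul, div_le_iff₀ hN']
    linarith

theorem IsBinaryEnvironment.isBoundedUnder_le (hP : IsBinaryEnvironment P) (K : PMF ℕ) (β h : ℝ) :
    IsBoundedUnder (· ≤ ·) atTop
      fun N : ℕ => (1 / (N : ℝ)) * ∫ ω, Real.log (partitionFunction K β h N ω) ∂P :=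
  isBoundedUnder_of ⟨|h| + |β|, fun N => (le_abs_self _).trans (hP.abs_mean_log_le K β h N)⟩

theorem IsBinaryEnvironment.isCoboundedUnder_le (hP : IsBinaryEnvironment P) (K : PMF ℕ)
    (β h : ℝ) : IsCoboundedUnder (· ≤ ·) atTop
      fun N : ℕ => (1 / (N : ℝ)) * ∫ ω, Real.log (partitionFunction K β h N ω) ∂P := by
  have : IsBoundedUnder (· ≥ ·) atTop
      fun N : ℕ => (1 / (N : ℝ)) * ∫ ω, Real.log (partitionFunction K β h N ω) ∂P :=
    isBoundedUnder_of ⟨-(|h| + |β|), fun N => neg_le_of_abs_le (hP.abs_mean_log_le K β h N)⟩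
  exact this.isCoboundedUnder_le

theorem IsBinaryEnvironment.freeEnergy_le (hP : IsBinaryEnvironment P) {K : PMF ℕ} {β h L : ℝ}
    {g : ℕ → ℝ} (hg : ∀ N : ℕ, ∫ ω, Real.log (partitionFunction K β h N ω) ∂P ≤ g N)
    (hL : Tendsto (fun N : ℕ => (1 / (N : ℝ)) * g N) atTop (𝓝 L)) :
    freeEnergy K P β h ≤ L := by
  rw [← hL.limsup_eq]
  exact limsup_le_limsup (Eventually.of_forall fun N =>
    mul_le_mul_of_nonneg_left (hg N) (by positivity)) (hP.isCoboundedUnder_le K β h)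
    hL.isBoundedUnder_le

/-- A limsup is bounded below along any sequence of volumes, so volumes can be taken to be multiples
of a block spacing. -/
theorem IsBinaryEnvironment.le_freeEnergy (hP : IsBinaryEnvironment P) {K : PMF ℕ} {β h L : ℝ}
    {g : ℕ → ℝ} {φ : ℕ → ℕ} (hφ : Tendsto φ atTop atTop)
    (hg : ∀ᶠ M in atTop, g M ≤ ∫ ω, Real.log (partitionFunction K β h (φ M) ω) ∂P)
    (hL : Tendsto (fun M : ℕ => (1 / (φ M : ℝ)) * g M) atTop (𝓝 L)) :
    L ≤ freeEnergy K P β h := by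
  refine le_of_forall_lt fun L' hL' => ?_
  obtain ⟨L'', h1, h2⟩ := exists_between hL'
  refine h1.trans_le (le_limsup_of_frequently_le ?_ (hP.isBoundedUnder_le K β h))
  refine hφ.frequently (Eventually.frequently ?_)
  filter_upwards [hg, hL.eventually_const_lt h2] with M hM1 hM2
  exact hM2.le.trans (mul_le_mul_of_nonneg_left hM1 (by positivity))

theorem tendsto_one_div_mul_affine (a b : ℝ) :
    Tendsto (fun N : ℕ => (1 / (N : ℝ)) * (a * N + b)) atTop (𝓝 a) := by
  have h : Tendsto (fun N : ℕ => a + b * (1 / (N : ℝ))) atTop (𝓝 (a + b * 0)) :=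
    tendsto_const_nhds.add (tendsto_one_div_atTop_nhds_zero_nat.const_mul b)
  rw [mul_zero, add_zero] at h
  refine h.congr' ?_
  filter_upwards [eventually_gt_atTop 0] with N hN
  have : (N : ℝ) ≠ 0 := by exact_mod_cast hN.ne'
  field_simp

theorem IsBinaryEnvironment.freeEnergy_nonpos (hP : IsBinaryEnvironment P) (K : PMF ℕ)
    {β h : ℝ} (hβ : 0 ≤ β) (hh : h ≤ -β) : freeEnergy K P β h ≤ 0 := by
  have := hP.isProbabilityMeasure
  refine hP.freeEnergy_le (g := fun _ => 0) (fun N => ?_) (by simp)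
  refine integral_nonpos_of_ae (hP.binary.mono fun ω hω => ?_)
  refine Real.log_nonpos (partitionFunction_pos K β h N ω).le (siteZ_le_one K fun n _ => ?_)
  rcases hω n with h1 | h1 <;> rw [h1] <;> linarith

/-! ### Lower bound on the homogeneous free energy -/

/-- Strictness allows truncating the series at some `R`; the whole volume is then one constant
stretch. The same `R` serves in the strategy with disorder. -/
theorem IsBinaryEnvironment.le_freeEnergy_zero (hP : IsBinaryEnvironment P) {K : PMF ℕ}
    (hK : K 0 = 0) {u lam : ℝ} (hu : 0 ≤ u) (hlam : 0 ≤ lam)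
    (h : Real.exp (-u) < ∑' n, (K n).toReal * Real.exp (-(lam * n))) :
    lam ≤ freeEnergy K P 0 u ∧ ∃ R : ℕ, Real.exp (-u) ≤
      ∑ n ∈ Finset.range (R + 1), (K n).toReal * Real.exp (-(lam * n)) := by
  have := hP.isProbabilityMeasure
  have hs : Summable fun n : ℕ => (K n).toReal * Real.exp (-(lam * n)) :=
    summable_toReal_mul K (C := 1) fun n => by
      rw [Real.abs_exp]
      exact Real.exp_le_one_iff.2 (by have : 0 ≤ lam * n := by positivity
                                      linarith)
  have ht := (tendsto_add_atTop_iff_nat 1).2 hs.hasSum.tendsto_sum_nat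
  obtain ⟨R, hR⟩ := (ht.eventually_const_lt h).exists
  refine ⟨?_, R, hR.le⟩
  refine hP.le_freeEnergy (φ := id) (g := fun N => lam * N + (-(lam * R))) tendsto_id
    (Eventually.of_forall fun N => ?_) (tendsto_one_div_mul_affine _ _)
  have hc : ∀ ω, lam * N + -(lam * R) ≤ Real.log (partitionFunction K 0 u N ω) := fun ω => by
    rw [Real.le_log_iff_exp_le (partitionFunction_pos _ _ _ _ _), partitionFunction_eq_siteZ]
    have := siteZ_ge_of_constant_stretch K hK hlam zero_le_one hR.le N N le_rfl
      (fun n => u + 0 * ω n) (fun n _ _ => by simp) (fun y _ => one_le_siteZ K fun n _ => by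
        simpa using hu)
    rw [one_mul] at this
    refine le_trans (le_of_eq ?_) this
    congr 1; ring
  have := integral_mono (integrable_const _) (hP.integrable_log K 0 u N) hc
  simpa using this

end Environment

theorem quarter_lt_one_sub_exp_neg {u : ℝ} (hu : 0 < u) (hu1 : u ≤ 1) :
    u / 4 < 1 - Real.exp (-u) := by
  have h1 : 1 + u ≤ Real.exp u := by linarith [Real.add_one_le_exp u]
  have h2 : Real.exp (-u) ≤ 1 / (1 + u) := by
    rw [Real.exp_neg, ← one_div]
    exact one_div_le_one_div_of_le (by linarith) h1
  have h3 : 1 / (1 + u) < 1 - u / 4 := by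
    rw [div_lt_iff₀ (by linarith)]
    nlinarith
  linarith

/-- Integral comparison done by induction; Bernoulli's inequality with exponent `1 - α` controls
each increment. -/
theorem sum_rpow_neg_le {α : ℝ} (hα0 : 0 < α) (hα1 : α < 1) (m : ℕ) :
    ∑ i ∈ Finset.range m, ((i + 1 : ℕ) : ℝ) ^ (-α) ≤ (m : ℝ) ^ (1 - α) / (1 - α) := by
  have h1 : (0 : ℝ) < 1 - α := by linarith
  induction m with
  | zero => simp [Real.zero_rpow h1.ne']
  | succ m ih =>
    rw [Finset.sum_range_succ]
    refine (add_le_add_left ih _).trans ?_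
    rw [le_div_iff₀ h1, add_mul, div_mul_cancel₀ _ h1.ne']
    set x : ℝ := ((m + 1 : ℕ) : ℝ) with hx
    have hx0 : 0 < x := by rw [hx]; positivity
    have hx1 : 1 ≤ x := by rw [hx]; push_cast; linarith [Nat.cast_nonneg (α := ℝ) m]
    have hm : (m : ℝ) = x * (1 + -(1 / x)) := by
      rw [hx]; field_simp; push_cast; ring
    have hs : -1 ≤ -(1 / x) := by
      rw [neg_le_neg_iff, div_le_one hx0]; exact hx1
    have hb := rpow_one_add_le_one_add_mul_self hs h1.le (by linarith)
    have hsplit : x ^ (1 - α) = x * x ^ (-α) := by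
      rw [sub_eq_add_neg, Real.rpow_add hx0, Real.rpow_one]
    rw [hm, Real.mul_rpow hx0.le (by linarith)]
    have hpos : 0 < x ^ (-α) := Real.rpow_pos_of_pos hx0 _
    calc x ^ (1 - α) * (1 + -(1 / x)) ^ (1 - α) + x ^ (-α) * (1 - α)
        ≤ x ^ (1 - α) * (1 + (1 - α) * -(1 / x)) + x ^ (-α) * (1 - α) := by
          gcongr
      _ = x ^ (1 - α) := by
          rw [hsplit]; field_simp; ring

theorem sum_tail_rpow_neg_le {α : ℝ} (hα0 : 0 < α) {m : ℕ} (hm : 1 ≤ m) (k : ℕ) :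
    ∑ i ∈ Finset.range k, ((i + (m + 1) : ℕ) : ℝ) ^ (-(1 + α)) ≤
      ((m : ℝ) ^ (-α) - ((m + k : ℕ) : ℝ) ^ (-α)) / α := by
  induction k with
  | zero => simp
  | succ k ih =>
    rw [Finset.sum_range_succ]
    refine (add_le_add_left ih _).trans ?_
    rw [le_div_iff₀ hα0, add_mul, div_mul_cancel₀ _ hα0.ne']
    have hidx : k + (m + 1) = m + (k + 1) := by omega
    rw [hidx]
    set x : ℝ := ((m + (k + 1) : ℕ) : ℝ) with hx
    have hx1 : 1 < x := by rw [hx]; exact_mod_cast (by omega : 1 < m + (k + 1))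
    have hx0 : 0 < x := by linarith
    have hy : ((m + k : ℕ) : ℝ) = x * (1 - 1 / x) := by
      rw [hx]; field_simp; push_cast; ring
    have h1x : 0 < 1 - 1 / x := by
      rw [sub_pos, div_lt_one hx0]; exact hx1
    have hb : 1 + α * (1 / x) ≤ (1 - 1 / x) ^ (-α) := by
      rw [Real.rpow_def_of_pos h1x]
      have hl := Real.log_le_sub_one_of_pos h1x
      have he := Real.add_one_le_exp (Real.log (1 - 1 / x) * -α)
      nlinarith
    rw [hy, Real.mul_rpow hx0.le h1x.le]
    have hsplit : x ^ (-(1 + α)) = x ^ (-α) * (1 / x) := by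
      rw [neg_add, add_comm, Real.rpow_add hx0, Real.rpow_neg_one, one_div]
    have hpos : 0 < x ^ (-α) := Real.rpow_pos_of_pos hx0 _
    have := mul_le_mul_of_nonneg_left hb hpos.le
    rw [hsplit]
    nlinarith

theorem one_sub_laplace_eq (K : PMF ℕ) {lam : ℝ} (hlam : 0 ≤ lam) :
    (Summable fun n : ℕ => (K n).toReal * (1 - Real.exp (-(lam * n)))) ∧
    ∑' n, (K n).toReal * Real.exp (-(lam * n)) =
      1 - ∑' n, (K n).toReal * (1 - Real.exp (-(lam * n))) := by
  have hle : ∀ n : ℕ, Real.exp (-(lam * n)) ≤ 1 := fun n =>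
    Real.exp_le_one_iff.2 (by have : 0 ≤ lam * n := by positivity
                              linarith)
  have hs : Summable fun n : ℕ => (K n).toReal * (1 - Real.exp (-(lam * n))) :=
    summable_toReal_mul K (C := 1) fun n => by
      rw [abs_of_nonneg (by linarith [hle n])]
      linarith [Real.exp_pos (-(lam * n))]
  refine ⟨hs, ?_⟩
  have h := ((hasSum_toReal K).sub hs.hasSum).tsum_eq
  rw [← h]
  exact tsum_congr fun n => by ring

/-- Bound `1 - exp (-n/m)` by `n/m` up to `m` and by 1 beyond; both parts are of order `m ^ (-α)`.
Rates of the form `1/m` make the cut an integer. -/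
theorem IsInterarrivalLaw.exists_laplace_lt_one {K : PMF ℕ} {α cK : ℝ}
    (hK : IsInterarrivalLaw K α cK) (hα : α < 1) :
    ∃ C > 0, ∀ m : ℕ, 1 ≤ m →
      1 - C * (m : ℝ) ^ (-α) ≤ ∑' n, (K n).toReal * Real.exp (-(1 / (m : ℝ) * n)) := by
  obtain ⟨C, hC, hp⟩ := hK.exists_upper
  have hα0 := hK.exponent_pos
  have h1α : 0 < 1 - α := by linarith
  refine ⟨C / (1 - α) + C / α, by positivity, fun m hm => ?_⟩
  have hm0 : (0 : ℝ) < m := by exact_mod_cast hm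
  obtain ⟨hs, he⟩ := one_sub_laplace_eq K (lam := 1 / (m : ℝ)) (by positivity)
  rw [he]
  refine sub_le_sub_left ?_ _
  rw [← hs.sum_add_tsum_nat_add (m + 1), add_mul]
  refine add_le_add ?_ ?_
  · rw [Finset.sum_range_succ']
    simp only [hK.apply_zero, ENNReal.toReal_zero, zero_mul, add_zero]
    calc ∑ i ∈ Finset.range m,
          (K (i + 1)).toReal * (1 - Real.exp (-(1 / (m : ℝ) * ((i + 1 : ℕ) : ℝ))))
        ≤ ∑ i ∈ Finset.range m, C / m * ((i + 1 : ℕ) : ℝ) ^ (-α) := by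
          refine Finset.sum_le_sum fun i _ => ?_
          have hx0 : (0 : ℝ) < ((i + 1 : ℕ) : ℝ) := by positivity
          have h1 : 1 - Real.exp (-(1 / (m : ℝ) * ((i + 1 : ℕ) : ℝ))) ≤
              1 / (m : ℝ) * ((i + 1 : ℕ) : ℝ) := by
            linarith [Real.add_one_le_exp (-(1 / (m : ℝ) * ((i + 1 : ℕ) : ℝ)))]
          refine (mul_le_mul_of_nonneg_left h1 ENNReal.toReal_nonneg).trans ?_
          refine (mul_le_mul_of_nonneg_right (hp (i + 1) (by omega)) (by positivity)).trans ?_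
          rw [neg_add, Real.rpow_add hx0, Real.rpow_neg_one]
          refine le_of_eq ?_
          field_simp
      _ ≤ C / m * ((m : ℝ) ^ (1 - α) / (1 - α)) := by
          rw [← Finset.mul_sum]
          exact mul_le_mul_of_nonneg_left (sum_rpow_neg_le hα0 hα m) (by positivity)
      _ = C / (1 - α) * (m : ℝ) ^ (-α) := by
          rw [sub_eq_add_neg, Real.rpow_add hm0, Real.rpow_one]
          field_simp
  · have hs' := (summable_nat_add_iff (m + 1)).2 hs
    refine Real.tsum_le_of_sum_range_le (fun i => ?_) fun k => ?_
    · refine mul_nonneg ENNReal.toReal_nonneg ?_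
      rw [sub_nonneg, Real.exp_le_one_iff, neg_nonpos]
      positivity
    · calc _ ≤ ∑ i ∈ Finset.range k, C * ((i + (m + 1) : ℕ) : ℝ) ^ (-(1 + α)) := by
            refine Finset.sum_le_sum fun i _ => ?_
            refine le_trans (mul_le_of_le_one_right ENNReal.toReal_nonneg ?_) (hp _ (by omega))
            linarith [Real.exp_pos (-(1 / (m : ℝ) * ((i + (m + 1) : ℕ) : ℝ)))]
        _ ≤ C * (((m : ℝ) ^ (-α) - ((m + k : ℕ) : ℝ) ^ (-α)) / α) := by
            rw [← Finset.mul_sum]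
            exact mul_le_mul_of_nonneg_left (sum_tail_rpow_neg_le hα0 hm k) hC.le
        _ ≤ C / α * (m : ℝ) ^ (-α) := by
            rw [div_mul_eq_mul_div, mul_div_assoc]
            gcongr
            have : 0 ≤ ((m + k : ℕ) : ℝ) ^ (-α) := by positivity
            linarith

/-- For `α > 1` the mean inter-arrival time is finite, so `1 - exp (-x) ≤ x` suffices. -/
theorem IsInterarrivalLaw.exists_laplace_one_lt {K : PMF ℕ} {α cK : ℝ}
    (hK : IsInterarrivalLaw K α cK) (hα : 1 < α) :
    ∃ C > 0, ∀ lam : ℝ, 0 ≤ lam →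
      1 - C * lam ≤ ∑' n, (K n).toReal * Real.exp (-(lam * n)) := by
  obtain ⟨C, hC, hp⟩ := hK.exists_upper
  have hsum : Summable fun n : ℕ => (K n).toReal * (n : ℝ) := by
    refine Summable.of_nonneg_of_le (fun n => mul_nonneg ENNReal.toReal_nonneg n.cast_nonneg)
      (fun n => ?_) ((Real.summable_nat_rpow.2 (by linarith : -α < -1)).mul_left C)
    rcases Nat.eq_zero_or_pos n with rfl | hn
    · simp; positivity
    · have hn0 : (0 : ℝ) < n := by exact_mod_cast hn
      refine (mul_le_mul_of_nonneg_right (hp n hn) n.cast_nonneg).trans (le_of_eq ?_)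
      rw [neg_add, Real.rpow_add hn0, Real.rpow_neg_one]
      field_simp
  refine ⟨(∑' n, (K n).toReal * (n : ℝ)) + 1, ?_, fun lam hlam => ?_⟩
  · have : 0 ≤ ∑' n, (K n).toReal * (n : ℝ) :=
      tsum_nonneg fun n => mul_nonneg ENNReal.toReal_nonneg n.cast_nonneg
    linarith
  · obtain ⟨hs, he⟩ := one_sub_laplace_eq K hlam
    rw [he]
    refine sub_le_sub_left ?_ _
    have h1 : ∑' n, (K n).toReal * (1 - Real.exp (-(lam * n))) ≤
        ∑' n, (K n).toReal * (n : ℝ) * lam := by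
      refine hs.tsum_le_tsum (fun n => ?_) (hsum.mul_right lam)
      rw [mul_assoc]
      refine mul_le_mul_of_nonneg_left ?_ ENNReal.toReal_nonneg
      linarith [Real.add_one_le_exp (-(lam * n))]
    rw [tsum_mul_right] at h1
    linarith

theorem IsInterarrivalLaw.exists_laplace_gt {K : PMF ℕ} {α cK : ℝ}
    (hK : IsInterarrivalLaw K α cK) (hα : α ≠ 1) :
    ∃ c > 0, ∃ u₁ > 0, ∀ u : ℝ, 0 < u → u ≤ u₁ → ∃ lam : ℝ,
      c * u ^ (max 1 (1 / α)) ≤ lam ∧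
      Real.exp (-u) < ∑' n, (K n).toReal * Real.exp (-(lam * n)) := by
  have hα0 := hK.exponent_pos
  rcases lt_or_gt_of_ne hα with h | h
  · obtain ⟨C, hC, hL⟩ := hK.exists_laplace_lt_one h
    have hmax : max 1 (1 / α) = 1 / α := max_eq_right (by rw [le_div_iff₀ hα0]; linarith)
    rw [hmax]
    refine ⟨1 / (2 * (4 * C) ^ (1 / α)), by positivity, min 1 (4 * C), by positivity,
      fun u hu hu1 => ?_⟩
    -- Solves `C * y ^ (-α) = u / 4`, which is below `1 - exp (-u)`. Rounding up costs at most a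
    -- factor 2.
    set y : ℝ := (4 * C / u) ^ (1 / α) with hy
    have hy1 : 1 ≤ y := by
      refine Real.one_le_rpow ?_ (by positivity)
      rw [le_div_iff₀ hu]; linarith [hu1.trans (min_le_right _ _)]
    have hm1 : 1 ≤ ⌈y⌉₊ := Nat.one_le_iff_ne_zero.2 (Nat.ceil_pos.2 (by linarith)).ne'
    have hm0 : (0 : ℝ) < ⌈y⌉₊ := by exact_mod_cast hm1
    refine ⟨1 / (⌈y⌉₊ : ℝ), ?_, ?_⟩
    · have h1 : (⌈y⌉₊ : ℝ) ≤ 2 * y := by linarith [Nat.ceil_lt_add_one (by linarith : 0 ≤ y)]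
      rw [Real.div_rpow (by positivity) hu.le] at hy
      rw [div_mul_eq_mul_div, one_mul]
      rw [div_le_div_iff₀ (by positivity) hm0, one_mul]
      have hup : 0 < u ^ (1 / α) := by positivity
      calc u ^ (1 / α) * (⌈y⌉₊ : ℝ) ≤ u ^ (1 / α) * (2 * y) := by gcongr
        _ = 2 * (4 * C) ^ (1 / α) := by rw [hy]; field_simp
    · refine lt_of_lt_of_le ?_ (hL ⌈y⌉₊ hm1)
      have h2 : C * (⌈y⌉₊ : ℝ) ^ (-α) ≤ u / 4 := by
        have h3 : (⌈y⌉₊ : ℝ) ^ (-α) ≤ y ^ (-α) :=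
          Real.rpow_le_rpow_of_nonpos (by linarith) (Nat.le_ceil y) (by linarith)
        have h4 : y ^ (-α) = u / (4 * C) := by
          rw [hy, ← Real.rpow_mul (by positivity), mul_neg, one_div_mul_cancel hα0.ne',
            Real.rpow_neg_one, inv_div]
        rw [h4] at h3
        calc C * (⌈y⌉₊ : ℝ) ^ (-α) ≤ C * (u / (4 * C)) := by gcongr
          _ = u / 4 := by field_simp
      linarith [quarter_lt_one_sub_exp_neg hu (hu1.trans (min_le_left _ _))]
  · obtain ⟨C, hC, hL⟩ := hK.exists_laplace_one_lt h
    have hmax : max 1 (1 / α) = 1 := max_eq_left (by rw [div_le_one hα0]; linarith)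
    rw [hmax]
    refine ⟨1 / (4 * C), by positivity, 1, one_pos, fun u hu hu1 =>
      ⟨1 / (4 * C) * u, by rw [Real.rpow_one], ?_⟩⟩
    refine lt_of_lt_of_le ?_ (hL _ (by positivity))
    have : C * (1 / (4 * C) * u) = u / 4 := by field_simp
    linarith [quarter_lt_one_sub_exp_neg hu hu1]

theorem IsInterarrivalLaw.exists_le_freeEnergy_zero {K : PMF ℕ} {α cK : ℝ}
    (hK : IsInterarrivalLaw K α cK) (hα : α ≠ 1) {P : Measure (ℕ → ℝ)}
    (hP : IsBinaryEnvironment P) :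
    ∃ c > 0, ∃ u₁ > 0, ∀ u : ℝ, 0 < u → u ≤ u₁ →
      c * u ^ (max 1 (1 / α)) ≤ freeEnergy K P 0 u := by
  obtain ⟨c, hc, u₁, hu₁, h⟩ := hK.exists_laplace_gt hα
  refine ⟨c, hc, u₁, hu₁, fun u hu hu1 => ?_⟩
  obtain ⟨lam, h1, h2⟩ := h u hu hu1
  have hlam : 0 ≤ lam := le_trans (by positivity) h1
  exact h1.trans (hP.le_freeEnergy_zero hK.apply_zero hu.le hlam h2).1

/-! ### Ergodic averages -/

section MeanErgodic

variable {Ω : Type*} [MeasurableSpace Ω] {μ : Measure Ω} {f : Ω → Ω}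

theorem coeFn_birkhoffSum (hf : MeasurePreserving f μ μ) {g : Ω → ℝ} (hg : MemLp g 2 μ) (n : ℕ) :
    (birkhoffSum (Lp.compMeasurePreserving (E := ℝ) (p := 2) f hf) id n (hg.toLp g) : Lp ℝ 2 μ)
      =ᵐ[μ] birkhoffSum f g n := by
  induction n with
  | zero =>
    rw [birkhoffSum_zero, birkhoffSum_zero']
    exact Lp.coeFn_zero ..
  | succ n ih =>
    rw [birkhoffSum_succ, Lp.compMeasurePreserving_iterate]
    refine (Lp.coeFn_add _ _).trans ?_
    have h1 := Lp.coeFn_compMeasurePreserving (hg.toLp g) (hf.iterate n)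
    have h2 := (hf.iterate n).quasiMeasurePreserving.ae_eq_comp hg.coeFn_toLp
    filter_upwards [ih, h1, h2] with x h3 h4 h5
    rw [birkhoffSum_succ, Pi.add_apply, h3]
    simp only [id]
    rw [h4, h5]
    rfl

/-- Von Neumann's theorem in `L²`: averages converge to the projection on invariant vectors, which
ergodicity makes constant. Convergence in measure is all that is needed. -/
theorem tendsto_measure_birkhoffSum_lt [IsProbabilityMeasure μ] (hf : Ergodic f μ) {s : Set Ω}
    (hs : MeasurableSet s) {c : ℝ} (hc : c < μ.real s) :
    Tendsto (fun n : ℕ => μ {x | birkhoffSum f (s.indicator 1) n x < c * n}) atTop (𝓝 0) := by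
  have hg : MemLp (s.indicator (1 : Ω → ℝ)) 2 μ := memLp_indicator_const 2 hs 1 (by simp)
  have h1 : MemLp (fun _ : Ω => (1 : ℝ)) 2 μ := memLp_const 1
  set T : Lp ℝ 2 μ →L[ℝ] Lp ℝ 2 μ :=
    (Lp.compMeasurePreservingₗᵢ ℝ f hf.toMeasurePreserving).toContinuousLinearMap with hT
  set x : Lp ℝ 2 μ := hg.toLp _ with hx
  have hlim := T.tendsto_birkhoffAverage_orthogonalProjection
    (LinearIsometry.norm_toContinuousLinearMap_le _) x
  set y : Lp ℝ 2 μ :=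
    ↑((T.eqLocus (1 : Lp ℝ 2 μ →L[ℝ] Lp ℝ 2 μ)).orthogonalProjectionOnto x) with hy
  have hyT : T y = y := by
    have : y ∈ T.eqLocus (1 : Lp ℝ 2 μ →L[ℝ] Lp ℝ 2 μ) := Subtype.property _
    simpa using this
  obtain ⟨c₀, hc₀⟩ := hf.ae_eq_const_of_ae_eq_comp_ae (g := y) (Lp.aestronglyMeasurable y) (by
    have := Lp.coeFn_compMeasurePreserving y hf.toMeasurePreserving
    refine this.symm.trans ?_
    have h2 : Lp.compMeasurePreserving f hf.toMeasurePreserving y = y := hyT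
    rw [h2])
  -- The constant 1 is invariant, hence orthogonal to `x - y`; pairing with it identifies the limit.
  have hc0 : c₀ = μ.real s := by
    have hone : h1.toLp _ ∈ T.eqLocus (1 : Lp ℝ 2 μ →L[ℝ] Lp ℝ 2 μ) := by
      change T (h1.toLp _) = h1.toLp _
      exact Lp.toLp_compMeasurePreserving h1 hf.toMeasurePreserving
    have hinner : inner ℝ (x - y) (h1.toLp _) = 0 :=
      Submodule.starProjection_inner_eq_zero (K := T.eqLocus (1 : Lp ℝ 2 μ →L[ℝ] Lp ℝ 2 μ))
        x _ hone
    rw [inner_sub_left, sub_eq_zero, L2.inner_def, L2.inner_def] at hinner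
    have e1 : ∫ a, inner ℝ (x a) (h1.toLp (fun _ => (1 : ℝ)) a) ∂μ = μ.real s := by
      rw [← integral_indicator_one hs]
      refine integral_congr_ae ?_
      filter_upwards [hg.coeFn_toLp, h1.coeFn_toLp] with a ha hb
      rw [hx, ha, hb]; simp
    have e2 : ∫ a, inner ℝ (y a) (h1.toLp (fun _ => (1 : ℝ)) a) ∂μ = c₀ := by
      rw [integral_congr_ae (g := fun _ => c₀)]
      · simp
      · filter_upwards [hc₀, h1.coeFn_toLp] with a ha hb
        rw [ha, hb]; simp
    rw [← e1, hinner, e2]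
  have hmeas := tendstoInMeasure_of_tendsto_Lp hlim
  have hmeas' := hmeas (ENNReal.ofReal (c₀ - c)) (by simpa [hc0] using hc)
  refine tendsto_of_tendsto_of_tendsto_of_le_of_le' tendsto_const_nhds hmeas'
    (Eventually.of_forall fun n => zero_le) ?_
  filter_upwards [eventually_gt_atTop 0] with n hn
  refine measure_mono_ae ?_
  have hn' : (0 : ℝ) < n := by exact_mod_cast hn
  have hcoe := coeFn_birkhoffSum hf.toMeasurePreserving hg n
  have hsm := Lp.coeFn_smul ((n : ℝ)⁻¹) (birkhoffSum T id n x)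
  filter_upwards [hcoe, hsm, hc₀] with a h2 h3 h4 h5
  change birkhoffSum f (s.indicator 1) n a < c * n at h5
  change ENNReal.ofReal (c₀ - c) ≤ edist ((birkhoffAverage ℝ T id n x : Lp ℝ 2 μ) a) (y a)
  rw [h4, birkhoffAverage, h3, edist_dist, Real.dist_eq, Pi.smul_apply]
  change _ ≤ ENNReal.ofReal |(n : ℝ)⁻¹ • (birkhoffSum
    (Lp.compMeasurePreserving (E := ℝ) (p := 2) f hf.toMeasurePreserving) id n (hg.toLp _) :
      Lp ℝ 2 μ) a - c₀|
  rw [h2]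
  refine ENNReal.ofReal_le_ofReal ?_
  rw [abs_sub_comm, smul_eq_mul]
  refine le_trans ?_ (le_abs_self _)
  have : (n : ℝ)⁻¹ * birkhoffSum f (s.indicator 1) n a < c := by
    rw [inv_mul_lt_iff₀ hn']; linarith
  linarith

end MeanErgodic

/-! ### Density of repulsive sites -/

theorem shift_iterate (s : ℕ) (ω : ℕ → ℝ) (i : ℕ) : shift^[s] ω i = ω (s + i) := by
  induction s generalizing ω with
  | zero => simp
  | succ s ih =>
    rw [Function.iterate_succ_apply, ih, shift]
    congr 1; omega

/-- The number of repulsive sites among the first `l` ones. -/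
def repulsiveCount (ω : ℕ → ℝ) (l : ℕ) : ℕ := ((Finset.range l).filter fun i => ω i = -1).card

/-- The event that the density of repulsive sites among the first `l` ones is less than `d`. -/
def sparse (d : ℝ) (l : ℕ) : Set (ℕ → ℝ) := {ω | (repulsiveCount ω l : ℝ) < d * l}

theorem repulsiveCount_eq_birkhoffSum (ω : ℕ → ℝ) (l : ℕ) :
    (repulsiveCount ω l : ℝ) =
      birkhoffSum shift ({ω : ℕ → ℝ | ω 0 = -1}.indicator (1 : (ℕ → ℝ) → ℝ)) l ω := by
  classical
  rw [repulsiveCount, Finset.card_filter, birkhoffSum]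
  push_cast
  refine Finset.sum_congr rfl fun i _ => ?_
  simp [Set.indicator_apply, shift_iterate]

theorem measurableSet_coord_eq (i : ℕ) (a : ℝ) : MeasurableSet {ω : ℕ → ℝ | ω i = a} :=
  measurableSet_eq_fun (measurable_pi_apply i) measurable_const

theorem measurableSet_sparse (d : ℝ) (l : ℕ) : MeasurableSet (sparse d l) := by
  have : Measurable fun ω : ℕ → ℝ => (repulsiveCount ω l : ℝ) := by
    simp only [repulsiveCount, Finset.card_filter]
    push_cast
    exact Finset.measurable_sum _ fun i _ =>
      Measurable.ite (measurableSet_coord_eq i (-1)) measurable_const measurable_const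
  exact measurableSet_lt this measurable_const

section Environment

variable {P : Measure (ℕ → ℝ)}

theorem IsBinaryEnvironment.measure_shift_preimage (hP : IsBinaryEnvironment P) (s : ℕ)
    {A : Set (ℕ → ℝ)} (hA : MeasurableSet A) : P (shift^[s] ⁻¹' A) = P A :=
  (hP.ergodic.toMeasurePreserving.iterate s).measure_preimage hA.nullMeasurableSet

theorem IsBinaryEnvironment.measure_coord_eq (hP : IsBinaryEnvironment P) (i j : ℕ) (a : ℝ) :
    P {ω | ω i = a} = P {ω | ω j = a} := by
  have h : ∀ i, P {ω | ω i = a} = P {ω | ω 0 = a} := fun i => by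
    rw [← hP.measure_shift_preimage i (measurableSet_coord_eq 0 a)]
    congr 1; ext ω; simp [shift_iterate]
  rw [h i, h j]

/-- Repulsive sites have positive density. -/
theorem IsBinaryEnvironment.repulsive_pos (hP : IsBinaryEnvironment P) :
    0 < P.real {ω | ω 0 = -1} := by
  have := hP.isProbabilityMeasure
  rw [measureReal_def]
  refine ENNReal.toReal_pos ?_ (measure_ne_top _ _)
  rw [hP.measure_coord_eq 0 1]
  exact hP.minus_pos.ne'

theorem IsBinaryEnvironment.tendsto_sparse (hP : IsBinaryEnvironment P) {d : ℝ}
    (hd : d < P.real {ω | ω 0 = -1}) :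
    Tendsto (fun l : ℕ => P.real (sparse d l)) atTop (𝓝 0) := by
  have := hP.isProbabilityMeasure
  have h := tendsto_measure_birkhoffSum_lt hP.ergodic (measurableSet_coord_eq 0 (-1)) hd
  simp only [← repulsiveCount_eq_birkhoffSum] at h
  exact (ENNReal.tendsto_toReal ENNReal.zero_ne_top).comp h

/-- Without rises, `ω 1 = 1` would force `ω 0 = 1`; by ergodicity this event would have measure 0 or
1, although both signs occur. -/
theorem IsBinaryEnvironment.rise_pos (hP : IsBinaryEnvironment P) :
    0 < P {ω | ω 0 = -1 ∧ ω 1 = 1} := by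
  have := hP.isProbabilityMeasure
  rw [pos_iff_ne_zero]
  intro h0
  have hle : shift ⁻¹' {ω | ω 0 = 1} ≤ᵐ[P] {ω : ℕ → ℝ | ω 0 = 1} := by
    have h1 : ∀ᵐ ω ∂P, ¬ (ω 0 = -1 ∧ ω 1 = 1) := by
      rw [ae_iff]; simpa using h0
    filter_upwards [h1, hP.binary] with ω h2 h3 h4
    have h5 : ω 1 = 1 := h4
    rcases h3 0 with h | h
    · exact h
    · exact absurd ⟨h, h5⟩ h2
  rcases hP.ergodic.ae_empty_or_univ_of_preimage_ae_le
    (measurableSet_coord_eq 0 1).nullMeasurableSet hle with h | h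
  · have h1 := measure_congr h
    rw [measure_empty, hP.measure_coord_eq 0 1] at h1
    exact hP.plus_pos.ne' h1
  · have h1 : P {ω | ω 0 = -1} = 0 := by
      have : ∀ᵐ ω ∂P, ¬ ω 0 = -1 := by
        filter_upwards [h.mem_iff] with ω hω h2
        have h3 : ω 0 = 1 := hω.2 trivial
        rw [h3] at h2; norm_num at h2
      rw [ae_iff] at this
      simpa using this
    rw [hP.measure_coord_eq 0 1] at h1
    exact hP.minus_pos.ne' h1

end Environment

/-! ### Upper bound on the quenched free energy -/

/-- A loss `θ` on a set of mass at least `ρ` leaves at most `exp u * (1 - (1 - exp (-θ)) * ρ)`, and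
the bracket is at most `1 - u ≤ exp (-u)`. -/
theorem tsum_exp_le_one (K : PMF ℕ) {g : ℕ → ℝ} {u θ ρ : ℝ} (A : Finset ℕ)
    (hg : ∀ n, g n ≤ u) (hθ : 0 ≤ θ) (hA : ∀ n ∈ A, g n ≤ u - θ)
    (hρ : ρ ≤ ∑ n ∈ A, (K n).toReal) (h : u ≤ (1 - Real.exp (-θ)) * ρ) :
    ∑' n, (K n).toReal * Real.exp (g n) ≤ 1 := by
  classical
  have hexp : 0 ≤ 1 - Real.exp (-θ) := by
    rw [sub_nonneg, Real.exp_le_one_iff]; linarith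
  have hs : Summable fun n => (K n).toReal * Real.exp (g n) :=
    summable_toReal_mul K (C := Real.exp u) fun n => by
      rw [Real.abs_exp]; exact Real.exp_le_exp.2 (hg n)
  have hI : HasSum (fun n => if n ∈ A then (K n).toReal else 0) (∑ n ∈ A, (K n).toReal) := by
    have := hasSum_sum_of_ne_finset_zero (f := fun n => if n ∈ A then (K n).toReal else 0)
      (s := A) (L := SummationFilter.unconditional ℕ) fun n hn => if_neg hn
    rwa [Finset.sum_congr rfl fun n hn => if_pos hn] at this
  have hB := ((hasSum_toReal K).sub (hI.mul_left (1 - Real.exp (-θ)))).mul_left (Real.exp u)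
  have h1 : ∑' n, (K n).toReal * Real.exp (g n) ≤
      Real.exp u * (1 - (1 - Real.exp (-θ)) * ∑ n ∈ A, (K n).toReal) := by
    rw [← hB.tsum_eq]
    refine hs.tsum_le_tsum (fun n => ?_) hB.summable
    have hp : 0 ≤ (K n).toReal := ENNReal.toReal_nonneg
    split_ifs with hn
    · have : Real.exp (g n) ≤ Real.exp u * Real.exp (-θ) := by
        rw [← Real.exp_add]; exact Real.exp_le_exp.2 (by linarith [hA n hn])
      calc (K n).toReal * Real.exp (g n) ≤ (K n).toReal * (Real.exp u * Real.exp (-θ)) := by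
            gcongr
        _ = _ := by ring
    · calc (K n).toReal * Real.exp (g n) ≤ (K n).toReal * Real.exp u := by
            gcongr; exact hg n
        _ = _ := by ring
  refine h1.trans ?_
  have h2 : 1 - (1 - Real.exp (-θ)) * ∑ n ∈ A, (K n).toReal ≤ Real.exp (-u) := by
    have h3 := mul_le_mul_of_nonneg_left hρ hexp
    have h4 := Real.add_one_le_exp (-u)
    linarith
  calc _ ≤ Real.exp u * Real.exp (-u) := by gcongr
    _ = 1 := by rw [← Real.exp_add, add_neg_cancel, Real.exp_zero]

theorem le_sum_of_subset_Icc (K : PMF ℕ) {α c d : ℝ} {n₀ l : ℕ} (hα : 0 < α) (hc : 0 < c)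
    (hn₀ : 1 ≤ n₀) (hp : ∀ n : ℕ, n₀ ≤ n → c * (n : ℝ) ^ (-(1 + α)) ≤ (K n).toReal)
    (hl : n₀ ≤ l) {A : Finset ℕ} (hA : A ⊆ Finset.Icc l (3 * l)) (hcard : d * l ≤ A.card) :
    c * d * 3 ^ (-(1 + α)) * (l : ℝ) ^ (-α) ≤ ∑ n ∈ A, (K n).toReal := by
  have hl0 : (0 : ℝ) < l := by exact_mod_cast (by omega : 0 < l)
  have h1 : ∀ n ∈ A, c * ((3 : ℝ) * l) ^ (-(1 + α)) ≤ (K n).toReal := by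
    intro n hn
    have hn' := Finset.mem_Icc.1 (hA hn)
    refine le_trans (mul_le_mul_of_nonneg_left ?_ hc.le) (hp n (by omega))
    refine Real.rpow_le_rpow_of_nonpos ?_ ?_ (by linarith)
    · exact_mod_cast (by omega : 0 < n)
    · exact_mod_cast hn'.2
  refine le_trans ?_ (Finset.card_nsmul_le_sum A _ _ h1)
  rw [nsmul_eq_mul, Real.mul_rpow (by norm_num) hl0.le, neg_add, Real.rpow_add hl0,
    Real.rpow_neg_one]
  have h3 : (0 : ℝ) < 3 ^ (-1 + -α) := by positivity
  have h4 : 0 < (l : ℝ) ^ (-α) := by positivity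
  calc c * d * 3 ^ (-1 + -α) * (l : ℝ) ^ (-α)
      = (d * l) * (c * (3 ^ (-1 + -α) * ((l : ℝ)⁻¹ * (l : ℝ) ^ (-α)))) := by field_simp
    _ ≤ _ := by gcongr

theorem site_le {ω : ℕ → ℝ} (hω : ∀ i, ω i = 1 ∨ ω i = -1) {β : ℝ} (hβ : 0 ≤ β) (u : ℝ) (n : ℕ) :
    -β + u + β * ω n ≤ u := by
  rcases hω n with h | h <;> rw [h] <;> linarith

theorem le_site {ω : ℕ → ℝ} (hω : ∀ i, ω i = 1 ∨ ω i = -1) {β u : ℝ} (hβ : 0 ≤ β) (hu : 0 ≤ u)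
    (n : ℕ) : -(2 * β) ≤ -β + u + β * ω n := by
  rcases hω n with h | h <;> rw [h] <;> linarith

/-- From every site of a block followed two steps later by a block with many repulsive sites, the
one-step kernel is a contraction. -/
theorem tsum_exp_le_one_of_notMem_sparse (K : PMF ℕ) {α c d θ β u : ℝ} {n₀ l : ℕ} (hα : 0 < α)
    (hc : 0 < c) (hn₀ : 1 ≤ n₀) (hp : ∀ n : ℕ, n₀ ≤ n → c * (n : ℝ) ^ (-(1 + α)) ≤ (K n).toReal)
    (hl : n₀ ≤ l) (hβ : 0 ≤ β) (hθ : 0 ≤ θ) (hθβ : θ ≤ 2 * β)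
    (hu : u ≤ (1 - Real.exp (-θ)) * (c * d * 3 ^ (-(1 + α)) * (l : ℝ) ^ (-α)))
    {ω : ℕ → ℝ} (hω : ∀ i, ω i = 1 ∨ ω i = -1) {V : ℕ → ℝ} (hV : Monotone V) {x : ℕ}
    (hx : shift^[(x / l + 2) * l] ω ∉ sparse d l) :
    ∑' n, (K n).toReal * Real.exp (-β + u + β * ω (x + n) - (V (x + n) - V x)) ≤ 1 := by
  have hlpos : 0 < l := by omega
  have hxl := Nat.div_add_mod' x l
  have hxm := Nat.mod_lt x hlpos
  have hmul : (x / l + 2) * l = x / l * l + 2 * l := by ring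
  -- Looking two blocks ahead puts every target at distance between `l` and `3 * l` from `x`, where
  -- the power-law lower bound applies.
  set B := (Finset.range l).filter fun i => ω ((x / l + 2) * l + i) = -1 with hB
  set A := B.image fun i => (x / l + 2) * l + i - x with hA
  have hcard : A.card = B.card := by
    refine Finset.card_image_of_injOn fun i _ j _ hij => ?_
    replace hij : (x / l + 2) * l + i - x = (x / l + 2) * l + j - x := hij
    omega
  refine tsum_exp_le_one K A (θ := θ) (fun n => ?_) hθ (fun n hn => ?_)
    (le_sum_of_subset_Icc K (d := d) hα hc hn₀ hp hl (fun n hn => ?_) ?_) hu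
  · linarith [site_le hω hβ u (x + n), hV (Nat.le_add_right x n)]
  · obtain ⟨i, hi, rfl⟩ := Finset.mem_image.1 hn
    rw [hB, Finset.mem_filter] at hi
    have hidx : x + ((x / l + 2) * l + i - x) = (x / l + 2) * l + i := by omega
    have hmono := hV (Nat.le_add_right x ((x / l + 2) * l + i - x))
    rw [hidx] at hmono ⊢
    rw [hi.2]
    linarith
  · obtain ⟨i, hi, rfl⟩ := Finset.mem_image.1 hn
    rw [hB, Finset.mem_filter, Finset.mem_range] at hi
    rw [Finset.mem_Icc]
    omega
  · rw [hcard]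
    have h1 : ¬ (repulsiveCount (shift^[(x / l + 2) * l] ω) l : ℝ) < d * l := hx
    rw [repulsiveCount] at h1
    simp only [shift_iterate] at h1
    exact not_lt.1 h1

/-- The supersolution potential rises by `κ` across each cell of length `m` whose block two steps
ahead is sparse. A jump of length at least `m` leaves the cell and collects that rise, so `hstep`
handles the bad cells. Since `m ∣ l`, a cell lies in one block and is entirely good or bad. By
stationarity the mean rise per site is the stated bound. -/
theorem IsBinaryEnvironment.freeEnergy_le_sparse {P : Measure (ℕ → ℝ)}
    (hP : IsBinaryEnvironment P) {K : PMF ℕ} (hK : K 0 = 0) {α c d θ β u κ : ℝ} {n₀ l m : ℕ}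
    (hα : 0 < α) (hc : 0 < c) (hn₀ : 1 ≤ n₀)
    (hp : ∀ n : ℕ, n₀ ≤ n → c * (n : ℝ) ^ (-(1 + α)) ≤ (K n).toReal)
    (hl : n₀ ≤ l) (hβ : 0 ≤ β) (hθ : 0 ≤ θ) (hθβ : θ ≤ 2 * β) (hu0 : 0 ≤ u)
    (hu : u ≤ (1 - Real.exp (-θ)) * (c * d * 3 ^ (-(1 + α)) * (l : ℝ) ^ (-α)))
    (hκ : 0 ≤ κ) (hml : m ∣ l)
    (hstep : ∀ g : ℕ → ℝ, (∀ n, g n ≤ u) → (∀ n, m ≤ n → g n ≤ u - κ) →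
      ∑' n, (K n).toReal * Real.exp (g n) ≤ 1) :
    freeEnergy K P β (-β + u) ≤ κ / m * P.real (sparse d l) := by
  classical
  have := hP.isProbabilityMeasure
  have hlpos : 0 < l := by omega
  have hmpos : 0 < m := Nat.pos_of_dvd_of_pos hml hlpos
  set E : ℕ → Set (ℕ → ℝ) := fun j => shift^[(j * m / l + 2) * l] ⁻¹' sparse d l with hE
  have hEm : ∀ j, MeasurableSet (E j) := fun j =>
    (hP.ergodic.toMeasurePreserving.iterate _).measurable (measurableSet_sparse d l)
  have hEP : ∀ j, P.real (E j) = P.real (sparse d l) := fun j => by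
    rw [measureReal_def, measureReal_def, hP.measure_shift_preimage _ (measurableSet_sparse d l)]
  refine hP.freeEnergy_le (g := fun N => κ / m * P.real (sparse d l) * N +
    (2 * β + κ * P.real (sparse d l))) (fun N => ?_) (tendsto_one_div_mul_affine _ _)
  set M := N / m + 1 with hM
  have hint : ∀ j, Integrable ((E j).indicator (fun _ => κ)) P := fun j =>
    (integrable_const κ).indicator (hEm j)
  have hmain : ∀ᵐ ω ∂P, Real.log (partitionFunction K β (-β + u) N ω) ≤
      2 * β + ∑ j ∈ Finset.range M, (E j).indicator (fun _ => κ) ω := by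
    filter_upwards [hP.binary] with ω hω
    have hv : ∀ j, 0 ≤ (E j).indicator (fun _ => κ) ω := fun j =>
      Set.indicator_nonneg (fun _ _ => hκ) _
    -- Freezing `V` after the `M` cells that meet `[0, N]` keeps it bounded without affecting
    -- starting points `x ≤ N`.
    set V : ℕ → ℝ := fun x => ∑ j ∈ Finset.range (min (x / m) M), (E j).indicator (fun _ => κ) ω
      with hVdef
    have hV : Monotone V := fun x y hxy =>
      Finset.sum_le_sum_of_subset_of_nonneg
        (Finset.range_mono (min_le_min_right _ (Nat.div_le_div_right hxy))) fun j _ _ => hv j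
    have hS : ∀ x, V x ≤ ∑ j ∈ Finset.range M, (E j).indicator (fun _ => κ) ω := fun x =>
      Finset.sum_le_sum_of_subset_of_nonneg (Finset.range_mono (min_le_right _ _)) fun j _ _ => hv j
    rw [Real.log_le_iff_le_exp (partitionFunction_pos _ _ _ _ _), partitionFunction_eq_siteZ]
    have h0 : V 0 = 0 := by simp [hVdef]
    have key := siteZ_le_of_supersolution K hK (N := N) (fun n => le_site hω hβ hu0 n)
      (fun n => site_le hω hβ u n) hV hS (fun x hx => ?_)
    · rwa [h0, sub_zero] at key
    · by_cases hbad : shift^[(x / l + 2) * l] ω ∈ sparse d l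
      · refine hstep _ (fun n => ?_) (fun n hn => ?_)
        · linarith [site_le hω hβ u (x + n), hV (Nat.le_add_right x n)]
        · have hxM : x / m < M := Nat.lt_succ_of_le (Nat.div_le_div_right hx)
          have hdiv : x / m * m / l = x / l := by
            obtain ⟨k, rfl⟩ := hml
            rw [mul_comm (x / m) m, Nat.mul_div_mul_left _ _ hmpos, Nat.div_div_eq_div_mul]
          have hmem : ω ∈ E (x / m) := by
            simp only [hE, Set.mem_preimage, hdiv]; exact hbad
          have hle : x / m + 1 ≤ (x + n) / m := by
            rw [← Nat.add_div_right x hmpos]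
            exact Nat.div_le_div_right (by omega)
          have h1 : V x + κ ≤ V (x + n) := by
            have h2 : V x + κ = ∑ j ∈ Finset.range (x / m + 1),
                (E j).indicator (fun _ => κ) ω := by
              rw [Finset.sum_range_succ, Set.indicator_of_mem hmem]
              simp only [hVdef, min_eq_left hxM.le]
            rw [h2]
            exact Finset.sum_le_sum_of_subset_of_nonneg
              (Finset.range_mono (le_min hle hxM)) fun j _ _ => hv j
          linarith [site_le hω hβ u (x + n)]
      · exact tsum_exp_le_one_of_notMem_sparse K hα hc hn₀ hp hl hβ hθ hθβ hu hω hV hbad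
  have hI : Integrable (fun ω => 2 * β + ∑ j ∈ Finset.range M,
      (E j).indicator (fun _ => κ) ω) P :=
    (integrable_const _).add (integrable_finsetSum _ fun j _ => hint j)
  refine (integral_mono_ae (hP.integrable_log K β (-β + u) N) hI hmain).trans ?_
  rw [integral_add (integrable_const _) (integrable_finsetSum _ fun j _ => hint j),
    integral_finsetSum _ fun j _ => hint j]
  simp only [integral_const, probReal_univ, one_mul, integral_indicator_const _ (hEm _), hEP,
    Finset.sum_const, Finset.card_range, smul_eq_mul, nsmul_eq_mul]
  have hMle : (M : ℝ) ≤ N / m + 1 := by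
    rw [hM]; push_cast
    linarith [Nat.cast_div_le (α := ℝ) (m := N) (n := m)]
  have hnn : 0 ≤ P.real (sparse d l) * κ := mul_nonneg measureReal_nonneg hκ
  calc 2 * β + (M : ℝ) * (P.real (sparse d l) * κ)
      ≤ 2 * β + (N / m + 1) * (P.real (sparse d l) * κ) := by gcongr
    _ = _ := by ring

/-! ### Nonnegativity of the free energy -/

theorem tendsto_exit_cost (c α : ℝ) (n₀ : ℕ) :
    Tendsto (fun N : ℕ => (1 / (N : ℝ)) *
      (Real.log c - (1 + α) * Real.log ((N + n₀ : ℕ) : ℝ))) atTop (𝓝 0) := by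
  have h1 : Tendsto (fun N : ℕ => ((N + n₀ : ℕ) : ℝ)) atTop atTop :=
    tendsto_natCast_atTop_atTop.comp (tendsto_add_atTop_nat n₀)
  have h2 : Tendsto (fun N : ℕ => Real.log ((N + n₀ : ℕ) : ℝ) / ((N + n₀ : ℕ) : ℝ)) atTop
      (𝓝 0) := (Real.isLittleO_log_id_atTop.tendsto_div_nhds_zero).comp h1
  have h3 : Tendsto (fun N : ℕ => 1 + (n₀ : ℝ) * (1 / (N : ℝ))) atTop (𝓝 (1 + n₀ * 0)) :=
    tendsto_const_nhds.add (tendsto_one_div_atTop_nhds_zero_nat.const_mul _)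
  have h4 := (tendsto_one_div_atTop_nhds_zero_nat (𝕜 := ℝ)).const_mul (Real.log c)
  have h5 := h4.sub ((h2.mul h3).const_mul (1 + α))
  simp only [mul_zero, zero_mul, sub_zero] at h5
  refine h5.congr' ?_
  filter_upwards [eventually_gt_atTop 0] with N hN
  have hN' : (N : ℝ) ≠ 0 := by exact_mod_cast hN.ne'
  have hN'' : ((N + n₀ : ℕ) : ℝ) ≠ 0 := by exact_mod_cast (by omega : N + n₀ ≠ 0)
  have : 1 + (n₀ : ℝ) * (1 / (N : ℝ)) = ((N + n₀ : ℕ) : ℝ) / N := by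
    push_cast; field_simp
  rw [this]
  field_simp

/-- One jump of length `N + n₀` leaves the system at polynomial cost, uniformly in `r ≤ N`; the
shift by `n₀` puts it in the range of the tail bound. -/
theorem exp_exit_cost_le (K : PMF ℕ) (hK : K 0 = 0) {α c : ℝ} (hc : 0 < c) {n₀ : ℕ}
    (hn₀ : 1 ≤ n₀) (hp : ∀ n : ℕ, n₀ ≤ n → c * (n : ℝ) ^ (-(1 + α)) ≤ (K n).toReal)
    (w : ℕ → ℝ) {r N : ℕ} (hr : r ≤ N) :
    Real.exp (Real.log c - (1 + α) * Real.log ((N + n₀ : ℕ) : ℝ)) ≤ siteZ K w r := by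
  have hpos : (0 : ℝ) < ((N + n₀ : ℕ) : ℝ) := by exact_mod_cast (by omega : 0 < N + n₀)
  refine le_trans (le_of_eq ?_) ((hp (N + n₀) (by omega)).trans
    (exit_le_siteZ K hK w (by omega)))
  rw [Real.rpow_def_of_pos hpos, sub_eq_add_neg, Real.exp_add, Real.exp_log hc]
  congr 2; ring

theorem IsInterarrivalLaw.freeEnergy_nonneg {K : PMF ℕ} {α cK : ℝ}
    (hK : IsInterarrivalLaw K α cK) {P : Measure (ℕ → ℝ)} (hP : IsBinaryEnvironment P) (β h : ℝ) :
    0 ≤ freeEnergy K P β h := by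
  have := hP.isProbabilityMeasure
  obtain ⟨c, hc, n₀, hn₀, hp⟩ := hK.exists_lower
  refine hP.le_freeEnergy (φ := id) tendsto_id (Eventually.of_forall fun N => ?_)
    (tendsto_exit_cost c α n₀)
  have hle : ∀ ω, Real.log c - (1 + α) * Real.log ((N + n₀ : ℕ) : ℝ) ≤
      Real.log (partitionFunction K β h N ω) := fun ω => by
    rw [Real.le_log_iff_exp_le (partitionFunction_pos _ _ _ _ _)]
    exact exp_exit_cost_le K hK.apply_zero hc hn₀ hp _ le_rfl
  simpa using integral_mono (integrable_const _) (hP.integrable_log K β h N) hle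

/-! ### The quenched free energy is negligible near the minimal critical point -/

theorem IsInterarrivalLaw.freeEnergy_isLittleO {K : PMF ℕ} {α cK : ℝ}
    (hK : IsInterarrivalLaw K α cK) (hα : α ≠ 1) {P : Measure (ℕ → ℝ)}
    (hP : IsBinaryEnvironment P) {β : ℝ} (hβ : 0 < β) :
    (fun u : ℝ => freeEnergy K P β (-β + u)) =o[𝓝[>] 0] fun u : ℝ => freeEnergy K P 0 u := by
  have := hP.isProbabilityMeasure
  obtain ⟨c, hc, n₀, hn₀, hp⟩ := hK.exists_lower
  obtain ⟨a, ha, u₁, hu₁, hF⟩ := hK.exists_le_freeEnergy_zero hα hP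
  have hα0 := hK.exponent_pos
  set ν := P.real {ω | ω 0 = -1} with hν
  have hν0 : 0 < ν := hP.repulsive_pos
  have hν1 : ν ≤ 1 := measureReal_le_one
  have hsp := hP.tendsto_sparse (d := ν / 2) (by linarith)
  set θ := min 1 (2 * β) with hθ
  have hθ0 : 0 < θ := lt_min one_pos (by linarith)
  have hexp : 0 < 1 - Real.exp (-θ) := by
    rw [sub_pos, Real.exp_lt_one_iff]; linarith
  set b := (1 - Real.exp (-θ)) * (c * (ν / 2) * 3 ^ (-(1 + α))) with hb
  have hb0 : 0 < b := by positivity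
  have hbu : ∀ (u : ℝ) (l : ℕ), u ≤ b * (l : ℝ) ^ (-α) →
      u ≤ (1 - Real.exp (-θ)) * (c * (ν / 2) * 3 ^ (-(1 + α)) * (l : ℝ) ^ (-α)) := by
    intro u l h
    rwa [← mul_assoc]
  suffices H : ∀ ε : ℝ, 0 < ε → ∃ u₂ > 0, ∀ u : ℝ, 0 < u → u ≤ u₂ →
      freeEnergy K P β (-β + u) ≤ ε * u ^ (max 1 (1 / α)) by
    refine isLittleO_iff.2 fun ε hε => ?_
    obtain ⟨u₂, hu₂, h⟩ := H (ε * a) (by positivity)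
    have hev : Set.Ioc 0 (min u₁ u₂) ∈ 𝓝[>] (0 : ℝ) := Ioc_mem_nhdsGT (lt_min hu₁ hu₂)
    filter_upwards [hev] with u hu
    have h1 := hF u hu.1 (hu.2.trans (min_le_left _ _))
    have h2 := h u hu.1 (hu.2.trans (min_le_right _ _))
    rw [Real.norm_of_nonneg (hK.freeEnergy_nonneg hP _ _),
      Real.norm_of_nonneg (hK.freeEnergy_nonneg hP _ _)]
    calc _ ≤ ε * (a * u ^ (max 1 (1 / α))) := by rw [← mul_assoc]; exact h2
      _ ≤ _ := by gcongr
  intro ε hε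
  rcases lt_or_gt_of_ne hα with h | h
  · have hmax : max 1 (1 / α) = 1 / α := max_eq_right (by rw [le_div_iff₀ hα0]; linarith)
    rw [hmax]
    have hδ : 0 < ε * b ^ (1 / α) / 2 := by positivity
    obtain ⟨l₀, hl₀⟩ := eventually_atTop.1 (hsp.eventually_lt_const hδ)
    set L : ℝ := ((l₀ + n₀ + 1 : ℕ) : ℝ) with hL
    have hL0 : 0 < L := by rw [hL]; positivity
    refine ⟨b / L ^ α, by positivity, fun u hu hu2 => ?_⟩
    -- The largest real block length at which the repulsive sites still absorb `u`: it solves `u = b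
    -- * y ^ (-α)`.
    set y : ℝ := (b / u) ^ (1 / α) with hy
    have hLy : L ≤ y := by
      have h1 : L ^ α ≤ b / u := by
        rw [le_div_iff₀ hu]
        rw [le_div_iff₀ (by positivity)] at hu2
        linarith
      have h2 : (L ^ α) ^ (1 / α) ≤ y := Real.rpow_le_rpow (by positivity) h1 (by positivity)
      rwa [← Real.rpow_mul hL0.le, mul_one_div_cancel hα0.ne', Real.rpow_one] at h2
    have hy0 : 0 < y := hL0.trans_le hLy
    set l := ⌊y⌋₊ with hl
    have hlL : l₀ + n₀ + 1 ≤ l := Nat.le_floor (by rw [← hL]; exact hLy)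
    have hl0 : (0 : ℝ) < l := by exact_mod_cast (by omega : 0 < l)
    have hly : (l : ℝ) ≤ y := Nat.floor_le hy0.le
    have hyl : y ≤ 2 * l := by
      have h1 := Nat.lt_floor_add_one y
      have h2 : (1 : ℝ) ≤ l := by exact_mod_cast (by omega : 1 ≤ l)
      rw [← hl] at h1
      linarith
    have hub : u ≤ b * (l : ℝ) ^ (-α) := by
      have h1 : y ^ (-α) ≤ (l : ℝ) ^ (-α) :=
        Real.rpow_le_rpow_of_nonpos hl0 hly (by linarith)
      have h2 : y ^ (-α) = u / b := by
        rw [hy, ← Real.rpow_mul (by positivity), mul_neg, one_div_mul_cancel hα0.ne',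
          Real.rpow_neg_one, inv_div]
      rw [h2, div_le_iff₀ hb0] at h1
      linarith
    -- In a bad cell, the factor `exp (-1)` on jumps of length in `[l, 2 * l)` replaces the
    -- repulsive sites: these jumps already carry mass of order `l ^ (-α)`.
    have hbd := hP.freeEnergy_le_sparse hK.apply_zero (m := l) (κ := 1) hα0 hc hn₀ hp
      (by omega : n₀ ≤ l) hβ.le hθ0.le (min_le_right _ _) hu.le (hbu u l hub) zero_le_one
      (dvd_refl l) (fun g hg hg' => by
        refine tsum_exp_le_one K (Finset.Ico l (2 * l)) (θ := θ) hg hθ0.le (fun n hn => ?_)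
          (le_sum_of_subset_Icc K (d := ν / 2) hα0 hc hn₀ hp (by omega : n₀ ≤ l) ?_ ?_)
          (hbu u l hub)
        · have := hg' n (Finset.mem_Ico.1 hn).1
          have h1 : θ ≤ 1 := min_le_left _ _
          linarith
        · intro n hn
          rw [Finset.mem_Ico] at hn
          rw [Finset.mem_Icc]; omega
        · rw [Nat.card_Ico, show 2 * l - l = l by omega]
          nlinarith)
    have hsl := (hl₀ l (by omega)).le
    refine hbd.trans ?_
    have hyb : y = b ^ (1 / α) / u ^ (1 / α) := by rw [hy, Real.div_rpow hb0.le hu.le]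
    have hub' : 0 < u ^ (1 / α) := by positivity
    have hbb' : 0 < b ^ (1 / α) := by positivity
    calc 1 / (l : ℝ) * P.real (sparse (ν / 2) l)
        ≤ (2 / y) * (ε * b ^ (1 / α) / 2) := by
          refine mul_le_mul ?_ hsl measureReal_nonneg (by positivity)
          rw [div_le_div_iff₀ hl0 hy0]; linarith
      _ = ε * u ^ (1 / α) := by rw [hyb]; field_simp
  · have hmax : max 1 (1 / α) = 1 := max_eq_left (by rw [div_le_one hα0]; linarith)
    rw [hmax]
    obtain ⟨l₀, hl₀⟩ := eventually_atTop.1 (hsp.eventually_lt_const hε)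
    set l := l₀ + n₀ with hl
    have hl0 : (0 : ℝ) < l := by exact_mod_cast (by omega : 0 < l)
    refine ⟨b * (l : ℝ) ^ (-α), by positivity, fun u hu hu2 => ?_⟩
    -- Here `l` depends only on `ε`; at a bad site a rise of `u` simply cancels the reward of every
    -- jump.
    have hbd := hP.freeEnergy_le_sparse hK.apply_zero (m := 1) (κ := u) hα0 hc hn₀ hp
      (by omega : n₀ ≤ l) hβ.le hθ0.le (min_le_right _ _) hu.le (hbu u l hu2) hu.le
      (one_dvd l) (fun g hg hg' => by
        have hs : Summable fun n => (K n).toReal * Real.exp (g n) :=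
          summable_toReal_mul K (C := Real.exp u) fun n => by
            rw [Real.abs_exp]; exact Real.exp_le_exp.2 (hg n)
        rw [← (hasSum_toReal K).tsum_eq]
        refine hs.tsum_le_tsum (fun n => ?_) (hasSum_toReal K).summable
        rcases Nat.eq_zero_or_pos n with rfl | hn
        · simp [hK.apply_zero]
        · refine mul_le_of_le_one_right ENNReal.toReal_nonneg (Real.exp_le_one_iff.2 ?_)
          linarith [hg' n hn])
    refine hbd.trans ?_
    rw [Real.rpow_one, Nat.cast_one, div_one, mul_comm]
    exact mul_le_mul_of_nonneg_right (hl₀ l (by omega)).le hu.le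

/-! ### Long attractive stretches under infinite disorder -/

/-- The event that the first `n` sites are attractive. -/
def attractiveRun (n : ℕ) : Set (ℕ → ℝ) := {ω | ∀ i < n, ω i = 1}

theorem measurableSet_attractiveRun (n : ℕ) : MeasurableSet (attractiveRun n) := by
  have : attractiveRun n = ⋂ i ∈ Finset.range n, {ω : ℕ → ℝ | ω i = 1} := by
    ext ω; simp [attractiveRun]
  rw [this]
  exact Finset.measurableSet_biInter _ fun i _ => measurableSet_coord_eq i 1

theorem blockEnd_succ_eq_coe {ω : ℕ → ℝ} {m t : ℕ} (h : blockEnd ω (m + 1) = t) :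
    ∃ t' : ℕ, blockEnd ω m = t' ∧ t' < t ∧ ω (t + 1) ≠ ω t ∧
      ∀ j, t' < j → j < t → ω (j + 1) = ω j := by
  rw [blockEnd] at h
  have hlt : (⨅ (i : ℕ) (_ : blockEnd ω m < (i : ℕ∞) ∧ ω (i + 1) ≠ ω i), (i : ℕ∞)) <
      ((t + 1 : ℕ) : ℕ∞) := by
    rw [h]; exact_mod_cast Nat.lt_succ_self t
  obtain ⟨i, hi⟩ := iInf_lt_iff.1 hlt
  obtain ⟨hi1, hi2⟩ := iInf_lt_iff.1 hi
  have hle : ∀ j : ℕ, blockEnd ω m < (j : ℕ∞) → ω (j + 1) ≠ ω j → t ≤ j := fun j h1 h2 => by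
    have : (t : ℕ∞) ≤ j := h ▸ iInf₂_le j ⟨h1, h2⟩
    exact_mod_cast this
  have hit : i = t := by
    have h1 := hle i hi1.1 hi1.2
    have h2 : i < t + 1 := by exact_mod_cast hi2
    omega
  subst hit
  obtain ⟨t', ht'⟩ := ENat.ne_top_iff_exists.1 (ne_top_of_lt hi1.1)
  rw [← ht'] at hi1 hle
  refine ⟨t', ht'.symm, by exact_mod_cast hi1.1, hi1.2, fun j h1 h2 => ?_⟩
  by_contra h3
  have := hle j (by exact_mod_cast h1) h3
  omega

theorem eq_of_constant_between {ω : ℕ → ℝ} {t' t : ℕ}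
    (h : ∀ j, t' < j → j < t → ω (j + 1) = ω j) (i : ℕ) (hi : t' + 1 + i ≤ t) :
    ω (t' + 1 + i) = ω (t' + 1) := by
  induction i with
  | zero => rfl
  | succ i ih =>
    rw [← ih (by omega), ← add_assoc]
    exact h _ (by omega) (by omega)

theorem apply_blockEnd_add_one {ω : ℕ → ℝ} (hω : ∀ i, ω i = 1 ∨ ω i = -1) (h1 : ω 1 = 1) (m : ℕ) :
    ∀ t : ℕ, blockEnd ω m = t → ω (t + 1) = (-1) ^ m := by
  induction m with
  | zero =>
    intro t ht
    have : t = 0 := by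
      rw [blockEnd] at ht
      exact_mod_cast ht.symm
    rw [this]; simpa using h1
  | succ m ih =>
    intro t ht
    obtain ⟨t', h2, h3, h4, h5⟩ := blockEnd_succ_eq_coe ht
    have h6 := eq_of_constant_between h5 (t - (t' + 1)) (by omega)
    rw [show t' + 1 + (t - (t' + 1)) = t by omega, ih t' h2] at h6
    rw [h6] at h4
    rw [pow_succ]
    rcases neg_one_pow_eq_or ℝ m with h7 | h7 <;> rw [h7] at h4 ⊢ <;>
      rcases hω (t + 1) with h8 | h8 <;> rw [h8] at h4 ⊢ <;> simp_all

theorem exists_attractiveRun_of_firstBlock_le {ω : ℕ → ℝ} (hω : ∀ i, ω i = 1 ∨ ω i = -1)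
    (h1 : ω 1 = 1) {A L : ℕ} (h : firstBlock ω A ≤ L) :
    ∃ s ≤ L, shift^[s] ω ∈ attractiveRun A := by
  have hlt : firstBlock ω A < ((L + 1 : ℕ) : ℕ∞) :=
    h.trans_lt (by exact_mod_cast Nat.lt_succ_self L)
  rw [firstBlock] at hlt
  obtain ⟨i, hi⟩ := iInf_lt_iff.1 hlt
  obtain ⟨hi1, hi2⟩ := iInf_lt_iff.1 hi
  obtain ⟨t, ht⟩ := ENat.ne_top_iff_exists.1 (ne_top_of_lt hi2)
  rw [← ht] at hi2
  have htL : t < L + 1 := by exact_mod_cast hi2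
  obtain ⟨t', h2, h3, -, h5⟩ := blockEnd_succ_eq_coe ht.symm
  rw [blockLength, ← ht, h2] at hi1
  have hAt : A ≤ t - t' := by exact_mod_cast hi1
  refine ⟨t' + 1, by omega, fun k hk => ?_⟩
  rw [shift_iterate, eq_of_constant_between h5 k (by omega),
    apply_blockEnd_add_one hω h1 _ t' h2]
  simp

theorem firstBlock_le_floor_of_log_lt {T : ℕ∞} {n : ℕ} (hn : 0 < n) {ε : ℝ}
    (h : ENNReal.log (T : ENNReal) / ((n : ℝ) : EReal) < (ε : EReal)) :
    T ≤ (⌊Real.exp (ε * n)⌋₊ : ℕ) := by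
  have hn' : (0 : ℝ) < n := by exact_mod_cast hn
  rw [EReal.div_lt_iff (by exact_mod_cast hn') (EReal.coe_ne_top _), ← EReal.coe_mul] at h
  have h2 : ENNReal.log (ENNReal.ofReal (Real.exp (ε * n))) = ((ε * n : ℝ) : EReal) := by
    rw [ENNReal.log_ofReal_of_pos (Real.exp_pos _), Real.log_exp]
  rw [← h2, ENNReal.log_lt_log_iff] at h
  have hT : T ≠ ⊤ := by
    rintro rfl
    simp at h
  obtain ⟨t, rfl⟩ := ENat.ne_top_iff_exists.1 hT
  rw [ENat.toENNReal_coe, ← ENNReal.ofReal_natCast, ENNReal.ofReal_lt_ofReal_iff (Real.exp_pos _)]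
    at h
  exact_mod_cast Nat.le_floor h.le

/-- If long runs were eventually exponentially rare, Borel-Cantelli would exclude them from windows
of smaller exponential size, whereas infinite disorder produces them there infinitely often. -/
theorem IsBinaryEnvironment.frequently_attractiveRun {P : Measure (ℕ → ℝ)}
    (hP : IsBinaryEnvironment P) (hI : InfiniteDisorder P) {ε : ℝ} (hε : 0 < ε) :
    ∃ᶠ n : ℕ in atTop, Real.exp (-(ε * n)) ≤ P.real (attractiveRun n) := by
  have := hP.isProbabilityMeasure
  intro hcon
  simp only [not_le] at hcon
  set D : Set (ℕ → ℝ) := {ω | ω 0 = -1 ∧ ω 1 = 1} with hD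
  have hDm : MeasurableSet D := (measurableSet_coord_eq 0 (-1)).inter (measurableSet_coord_eq 1 1)
  have hprob : IsProbabilityMeasure (cond P D) := cond_isProbabilityMeasure hP.rise_pos.ne'
  -- A union bound over this window against `exp (-ε n)` leaves the summable `exp (-2 ε n / 3)`.
  set L : ℕ → ℕ := fun n => ⌊Real.exp (ε / 3 * n)⌋₊ with hL
  have hnull : P {ω | ∃ᶠ n in atTop, ∃ s ≤ L n, shift^[s] ω ∈ attractiveRun n} = 0 := by
    obtain ⟨n₀, hn₀⟩ := eventually_atTop.1 hcon
    have hbound : ∀ n, n₀ ≤ n → P {ω | ∃ s ≤ L n, shift^[s] ω ∈ attractiveRun n} ≤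
        ENNReal.ofReal (2 * Real.exp (-(2 * ε / 3)) ^ n) := by
      intro n hn
      have hsub : {ω | ∃ s ≤ L n, shift^[s] ω ∈ attractiveRun n} ⊆
          ⋃ s ∈ Finset.range (L n + 1), shift^[s] ⁻¹' attractiveRun n := by
        rintro ω ⟨s, hs, h⟩
        simp only [Set.mem_iUnion, Finset.mem_range]
        exact ⟨s, by omega, h⟩
      refine (measure_mono hsub).trans ((measure_biUnion_finset_le _ _).trans ?_)
      simp only [hP.measure_shift_preimage _ (measurableSet_attractiveRun n), Finset.sum_const,
        Finset.card_range, nsmul_eq_mul]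
      rw [← ofReal_measureReal, ← ENNReal.ofReal_natCast,
        ← ENNReal.ofReal_mul (Nat.cast_nonneg _)]
      refine ENNReal.ofReal_le_ofReal ?_
      have h1 : ((L n + 1 : ℕ) : ℝ) ≤ 2 * Real.exp (ε / 3 * n) := by
        have h2 := Nat.floor_le (Real.exp_nonneg (ε / 3 * n))
        have h3 : 1 ≤ Real.exp (ε / 3 * n) := Real.one_le_exp (by positivity)
        push_cast
        linarith
      calc ((L n + 1 : ℕ) : ℝ) * P.real (attractiveRun n)
          ≤ (2 * Real.exp (ε / 3 * n)) * Real.exp (-(ε * n)) :=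
            mul_le_mul h1 (hn₀ n hn).le measureReal_nonneg (by positivity)
        _ = 2 * Real.exp (-(2 * ε / 3)) ^ n := by
            rw [mul_assoc, ← Real.exp_add, ← Real.exp_nat_mul]
            congr 2; ring
    have hsum : Summable fun n : ℕ => 2 * Real.exp (-(2 * ε / 3)) ^ n :=
      (summable_geometric_of_lt_one (Real.exp_nonneg _)
        (Real.exp_lt_one_iff.2 (by linarith [hε]))).mul_left 2
    have hzero : P {ω | ∃ᶠ n in atTop, n₀ ≤ n ∧
        ∃ s ≤ L n, shift^[s] ω ∈ attractiveRun n} = 0 := by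
      refine measure_setOfPred_frequently_eq_zero (ne_top_of_le_ne_top hsum.tsum_ofReal_ne_top
        (ENNReal.tsum_le_tsum fun n => ?_))
      by_cases hn : n₀ ≤ n
      · simpa only [hn, true_and] using hbound n hn
      · simp [hn]
    refine measure_mono_null (fun ω hω => ?_) hzero
    exact (hω.and_eventually (eventually_ge_atTop n₀)).mono fun n h => ⟨h.2, h.1⟩
  -- Stationarity was used under `P`; the null set passes to the conditioned law by absolute
  -- continuity.
  have hac : ∀ᵐ ω ∂(cond P D),
      ¬ ∃ᶠ n in atTop, ∃ s ≤ L n, shift^[s] ω ∈ attractiveRun n := by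
    refine cond_absolutelyContinuous.ae_le (?_ : ∀ᵐ ω ∂P, _)
    rw [ae_iff]
    simpa only [not_not] using hnull
  have hbin : ∀ᵐ ω ∂(cond P D), ∀ i, ω i = 1 ∨ ω i = -1 :=
    cond_absolutelyContinuous.ae_le hP.binary
  obtain ⟨ω, h1, h2, h3, h4⟩ :=
    (hac.and (hbin.and ((ae_cond_mem hDm).and hI))).exists
  refine h1 ?_
  have hlt : liminf (fun n : ℕ => ENNReal.log (firstBlock ω n : ENNReal) / ((n : ℝ) : EReal)) atTop
      < ((ε / 3 : ℝ) : EReal) := by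
    rw [h4]; exact_mod_cast (by linarith : 0 < ε / 3)
  refine ((frequently_lt_of_liminf_lt (by isBoundedDefault) hlt).and_eventually
    (eventually_ge_atTop 1)).mono fun n hn => ?_
  exact exists_attractiveRun_of_firstBlock_le h2 h3.2
    (firstBlock_le_floor_of_log_lt (by omega) hn.1)

/-! ### Positivity of the free energy when long attractive stretches are not too rare -/

/-- Replacing `log d` by its tangent at `B` makes jump costs affine in the length, so the total
depends only on the number of jumps and the distance covered, not on the random gaps. -/
theorem exp_jump_cost_le (K : PMF ℕ) {α c B : ℝ} (hα : 0 < α) (hc : 0 < c) (hB : 0 < B) {n₀ : ℕ}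
    (hn₀ : 1 ≤ n₀) (hp : ∀ n : ℕ, n₀ ≤ n → c * (n : ℝ) ^ (-(1 + α)) ≤ (K n).toReal) {d : ℕ}
    (hd : n₀ ≤ d) :
    Real.exp (Real.log c - (1 + α) * (Real.log B - 1 + d / B)) ≤ (K d).toReal := by
  have hpos : (0 : ℝ) < d := by exact_mod_cast (by omega : 0 < d)
  refine le_trans ?_ (hp d hd)
  rw [Real.rpow_def_of_pos hpos]
  nth_rewrite 2 [← Real.exp_log hc]
  rw [← Real.exp_add]
  refine Real.exp_le_exp.2 ?_
  have h1 := Real.log_le_sub_one_of_pos (div_pos hpos hB)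
  rw [Real.log_div hpos.ne' hB.ne'] at h1
  nlinarith

/-- Strategy visiting the attractive blocks `(2 * j * n, 2 * j * n + n]` and jumping from one to the
next. -/
theorem le_siteZ_of_attractive_blocks (K : PMF ℕ) (hK : K 0 = 0) {α c B lam β u A e : ℝ}
    {n₀ n R M N : ℕ} (hα : 0 < α) (hc : 0 < c) (hB : 0 < B) (hn₀ : 1 ≤ n₀)
    (hp : ∀ n : ℕ, n₀ ≤ n → c * (n : ℝ) ^ (-(1 + α)) ≤ (K n).toReal)
    (hn : n₀ ≤ n) (hβ : 0 ≤ β) (hu : 0 ≤ u) (hlam : 0 ≤ lam)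
    (hR : Real.exp (-u) ≤ ∑ n ∈ Finset.range (R + 1), (K n).toReal * Real.exp (-(lam * n)))
    (hA : A = lam * (n - R) - 2 * β + Real.log c - (1 + α) * (Real.log B - 1))
    (hN : N = 2 * M * n) (he : ∀ (w : ℕ → ℝ) (r : ℕ), r ≤ N → Real.exp e ≤ siteZ K w r)
    {ω : ℕ → ℝ} (hω : ∀ i, ω i = 1 ∨ ω i = -1) {a : ℕ → ℝ}
    (ha : ∀ j, a j = 0 ∨ (a j = A ∧ shift^[2 * j * n + 1] ω ∈ attractiveRun n)) :
    ∀ k j : ℕ, j + k = M → ∀ y : ℕ, y + n ≤ 2 * j * n →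
      Real.exp (∑ i ∈ Finset.Ico j M, a i - (1 + α) * ((N - y : ℕ) : ℝ) / B + e) ≤
        siteZ K (fun m => -β + u + β * ω (y + m)) (N - y) := by
  intro k
  induction k with
  | zero =>
    intro j hj y hy
    have hjM : j = M := by omega
    subst hjM
    refine le_trans (Real.exp_le_exp.2 ?_) (he _ (N - y) (Nat.sub_le _ _))
    simp only [Finset.Ico_self, Finset.sum_empty]
    have : 0 ≤ (1 + α) * ((N - y : ℕ) : ℝ) / B := by positivity
    linarith
  | succ k ih =>
    intro j hj y hy
    have hjM : j < M := by omega
    have hstep : 2 * (j + 1) * n = 2 * j * n + 2 * n := by ring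
    have hjN : 2 * (j + 1) * n ≤ N := by
      rw [hN]; exact Nat.mul_le_mul_right n (by omega)
    rw [Finset.sum_eq_sum_Ico_succ_bot hjM]
    rcases ha j with h0 | ⟨h0, hrun⟩
    · rw [h0, zero_add]
      exact ih (j + 1) (by omega) y (by omega)
    · rw [h0]
      set x := 2 * j * n with hx
      set S := ∑ i ∈ Finset.Ico (j + 1) M, a i with hS
      obtain ⟨d, hd⟩ : ∃ d, x = y + d := ⟨x - y, by omega⟩
      -- Wherever the path stands within `n` sites of `x`, the next candidate block is still at
      -- least `n` away, because the spacing is `2 * n`; this restores the induction hypothesis.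
      have hstretch := siteZ_ge_of_constant_stretch K hK hlam
        (Real.exp_nonneg (S - (1 + α) * ((N - x : ℕ) : ℝ) / B + e)) hR n (N - x)
        (by omega) (fun m => -β + u + β * ω (x + m)) (fun m hm1 hm2 => by
          have h1 := hrun (m - 1) (by omega)
          rw [shift_iterate, show x + 1 + (m - 1) = x + m by omega] at h1
          simp only [h1]; ring) (fun z hz => by
          have h1 := ih (j + 1) (by omega) (x + z) (by omega)
          simp only [← add_assoc, Nat.sub_sub]
          refine le_trans (Real.exp_le_exp.2 ?_) h1
          have h2 : ((N - (x + z) : ℕ) : ℝ) ≤ ((N - x : ℕ) : ℝ) := by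
            exact_mod_cast (by omega : N - (x + z) ≤ N - x)
          have h3 : (1 + α) * ((N - (x + z) : ℕ) : ℝ) / B ≤ (1 + α) * ((N - x : ℕ) : ℝ) / B := by
            gcongr
          linarith)
      have hjump := jump_le_siteZ K hK (fun m => -β + u + β * ω (y + m))
        (N := N - y) (n := d) (by omega)
      simp only [← add_assoc, ← hd, Nat.sub_sub] at hjump
      refine le_trans ?_ hjump
      have hcost := exp_jump_cost_le K hα hc hB hn₀ hp (by omega : n₀ ≤ d)
      -- The landing site `x` precedes the run, so its sign is unknown and it is charged the worst
      -- value `-2β`.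
      have hw := Real.exp_le_exp.2 (le_site hω hβ hu x)
      refine le_trans (le_of_eq ?_) (mul_le_mul hcost (mul_le_mul hw hstretch
        (by positivity) (Real.exp_nonneg _)) (by positivity) ENNReal.toReal_nonneg)
      rw [← Real.exp_add, ← Real.exp_add, ← Real.exp_add]
      congr 1
      have h1 : ((N - y : ℕ) : ℝ) = d + ((N - x : ℕ) : ℝ) := by
        exact_mod_cast (by omega : N - y = d + (N - x))
      rw [h1, hA]
      ring

theorem IsBinaryEnvironment.le_freeEnergy_of_attractiveRun {P : Measure (ℕ → ℝ)}
    (hP : IsBinaryEnvironment P) {K : PMF ℕ} (hK : K 0 = 0) {α c lam β u : ℝ}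
    {n₀ n R : ℕ} (hα : 0 < α) (hc : 0 < c) (hn₀ : 1 ≤ n₀)
    (hp : ∀ n : ℕ, n₀ ≤ n → c * (n : ℝ) ^ (-(1 + α)) ≤ (K n).toReal)
    (hn : n₀ ≤ n) (hβ : 0 ≤ β) (hu : 0 ≤ u) (hlam : 0 ≤ lam)
    (hR : Real.exp (-u) ≤ ∑ n ∈ Finset.range (R + 1), (K n).toReal * Real.exp (-(lam * n)))
    (hq : 0 < P.real (attractiveRun n)) :
    P.real (attractiveRun n) * (lam * (n - R) - 2 * β + Real.log c -
      (1 + α) * Real.log (2 * n / P.real (attractiveRun n))) / (2 * n) ≤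
      freeEnergy K P β (-β + u) := by
  classical
  have := hP.isProbabilityMeasure
  set q := P.real (attractiveRun n) with hqdef
  have hn1 : 0 < n := by omega
  have hn' : (0 : ℝ) < n := by exact_mod_cast hn1
  -- The mean distance between good blocks. The linear part of the jump costs then averages `(1 + α)
  -- * q` per candidate block, cancelling the `+(1 + α)` contained in `A`.
  set B := 2 * n / q with hBdef
  have hB : 0 < B := by positivity
  set A := lam * (n - R) - 2 * β + Real.log c - (1 + α) * (Real.log B - 1) with hA
  set φ : ℕ → ℕ := fun M => 2 * M * n with hφ
  have hφt : Tendsto φ atTop atTop := by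
    refine tendsto_atTop_mono (fun M => ?_) tendsto_id
    simp only [hφ, id]
    nlinarith
  set E : ℕ → Set (ℕ → ℝ) := fun j => shift^[2 * j * n + 1] ⁻¹' attractiveRun n with hE
  have hEm : ∀ j, MeasurableSet (E j) := fun j =>
    (hP.ergodic.toMeasurePreserving.iterate _).measurable (measurableSet_attractiveRun n)
  have hEP : ∀ j, P.real (E j) = q := fun j => by
    rw [hqdef, measureReal_def, measureReal_def,
      hP.measure_shift_preimage _ (measurableSet_attractiveRun n)]
  have hint : ∀ j, Integrable ((E j).indicator (fun _ => A)) P := fun j =>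
    (integrable_const A).indicator (hEm j)
  set e : ℕ → ℝ := fun N => Real.log c - (1 + α) * Real.log ((N + n₀ : ℕ) : ℝ) with he
  refine hP.le_freeEnergy hφt (g := fun M => (A * q - (1 + α) * q) * M + (-(A * q)) + e (φ M))
    ?_ ?_
  · filter_upwards [eventually_ge_atTop 1] with M hM
    have hmain : ∀ᵐ ω ∂P, ∑ j ∈ Finset.Ico 1 M, (E j).indicator (fun _ => A) ω +
        (-((1 + α) * (φ M : ℝ) / B) + e (φ M)) ≤
        Real.log (partitionFunction K β (-β + u) (φ M) ω) := by
      filter_upwards [hP.binary] with ω hω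
      -- Block 0 is skipped: starting from 0, the required gap of `n` is available only from `j = 1`
      -- on.
      have key := le_siteZ_of_attractive_blocks K hK (e := e (φ M)) (M := M) hα hc hB hn₀ hp hn hβ
        hu hlam hR hA rfl (fun w r hr => exp_exit_cost_le K hK hc hn₀ hp w hr) hω
        (a := fun j => (E j).indicator (fun _ => A) ω) (fun j => by
          by_cases hj : ω ∈ E j
          · exact Or.inr ⟨Set.indicator_of_mem hj _, hj⟩
          · exact Or.inl (Set.indicator_of_notMem hj _)) (M - 1) 1 (by omega) 0 (by omega)
      rw [Real.le_log_iff_exp_le (partitionFunction_pos _ _ _ _ _), partitionFunction_eq_siteZ]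
      simp only [zero_add, Nat.sub_zero] at key
      refine le_trans (le_of_eq ?_) key
      congr 1; ring
    have hI1 := integrable_finsetSum (μ := P) (Finset.Ico 1 M) fun j _ => hint j
    refine le_trans (le_of_eq ?_) (integral_mono_ae
      (hI1.add (integrable_const (-((1 + α) * (φ M : ℝ) / B) + e (φ M))))
      (hP.integrable_log K β (-β + u) (φ M)) hmain)
    simp only [Pi.add_apply]
    rw [integral_add hI1 (integrable_const _), integral_finsetSum _ fun j _ => hint j]
    simp only [integral_const, probReal_univ, integral_indicator_const _ (hEm _), hEP,
      Finset.sum_const, Nat.card_Ico, smul_eq_mul, nsmul_eq_mul, one_mul]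
    rw [Nat.cast_sub hM, hBdef]
    simp only [hφ]
    push_cast
    field_simp
    ring
  · have h1 := ((tendsto_one_div_mul_affine (A * q - (1 + α) * q) (-(A * q))).const_mul
      (1 / (2 * (n : ℝ)))).add ((tendsto_exit_cost c α n₀).comp hφt)
    have hlim : 1 / (2 * (n : ℝ)) * (A * q - (1 + α) * q) + 0 =
        q * (lam * (n - R) - 2 * β + Real.log c - (1 + α) * Real.log B) / (2 * n) := by
      rw [hA]; field_simp; ring
    rw [hlim] at h1
    refine h1.congr fun M => ?_
    simp only [Function.comp_apply, he]
    rw [mul_add (1 / (φ M : ℝ))]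
    congr 1
    rw [← mul_assoc]
    congr 1
    simp only [hφ]
    push_cast
    rw [div_mul_div_comm]
    congr 1 <;> ring

theorem IsInterarrivalLaw.freeEnergy_pos {K : PMF ℕ} {α cK : ℝ}
    (hK : IsInterarrivalLaw K α cK) (hα : α ≠ 1) {P : Measure (ℕ → ℝ)}
    (hP : IsBinaryEnvironment P) (hI : InfiniteDisorder P) {β : ℝ} (hβ : 0 ≤ β) :
    ∃ u₁ > 0, ∀ u : ℝ, 0 < u → u ≤ u₁ → 0 < freeEnergy K P β (-β + u) := by
  obtain ⟨c, hc, n₀, hn₀, hp⟩ := hK.exists_lower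
  obtain ⟨a, ha, u₁, hu₁, hL⟩ := hK.exists_laplace_gt hα
  have hα0 := hK.exponent_pos
  refine ⟨u₁, hu₁, fun u hu hu1 => ?_⟩
  obtain ⟨lam, h1, h2⟩ := hL u hu hu1
  have hlam : 0 < lam := lt_of_lt_of_le (by positivity) h1
  obtain ⟨-, R, hR⟩ := hP.le_freeEnergy_zero hK.apply_zero hu.le hlam.le h2
  -- Budget for the gain `lam * n`: a quarter for `log (2 * n)`, a quarter for the constants, and a
  -- half for the rarity of runs.
  set δ := lam / (8 * (1 + α)) with hδ
  have hδ0 : 0 < δ := by positivity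
  have hlog : ∀ᶠ n : ℕ in atTop, Real.log (2 * n) ≤ δ * (2 * n) := by
    have ht : Tendsto (fun n : ℕ => 2 * (n : ℝ)) atTop atTop :=
      tendsto_natCast_atTop_atTop.const_mul_atTop two_pos
    filter_upwards [ht.eventually (isLittleO_iff.1 Real.isLittleO_log_id_atTop hδ0)] with n hn
    simp only [id, Real.norm_eq_abs] at hn
    rw [abs_of_nonneg (by positivity : (0 : ℝ) ≤ 2 * n)] at hn
    exact (le_abs_self _).trans hn
  have hlin : ∀ᶠ n : ℕ in atTop,
      lam * R + 2 * β - Real.log c < lam / 4 * n :=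
    (tendsto_natCast_atTop_atTop.const_mul_atTop (by positivity)).eventually_gt_atTop _
  obtain ⟨n, hq, hln, hli, hnn⟩ := ((hP.frequently_attractiveRun hI
    (ε := lam / (2 * (1 + α))) (by positivity)).and_eventually
    (hlog.and (hlin.and (eventually_ge_atTop n₀)))).exists
  have hq0 : 0 < P.real (attractiveRun n) := (Real.exp_pos _).trans_le hq
  have hn' : (0 : ℝ) < n := by exact_mod_cast (by omega : 0 < n)
  refine lt_of_lt_of_le ?_ (hP.le_freeEnergy_of_attractiveRun hK.apply_zero hα0 hc hn₀ hp hnn hβ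
    hu.le hlam.le hR hq0)
  refine div_pos (mul_pos hq0 ?_) (by positivity)
  rw [Real.log_div (by positivity) hq0.ne']
  have hlq := (Real.le_log_iff_exp_le hq0).2 hq
  have h3 : (1 + α) * Real.log (2 * n) ≤ lam / 4 * n := by
    calc (1 + α) * Real.log (2 * n) ≤ (1 + α) * (δ * (2 * n)) := by gcongr
      _ = lam / 4 * n := by rw [hδ]; field_simp; ring
  have h4 : -(lam / 2 * n) ≤ (1 + α) * Real.log (P.real (attractiveRun n)) := by
    calc -(lam / 2 * n) = (1 + α) * (-(lam / (2 * (1 + α)) * n)) := by field_simp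
      _ ≤ _ := by gcongr
  nlinarith

theorem IsInterarrivalLaw.criticalPoint_eq {K : PMF ℕ} {α cK : ℝ}
    (hK : IsInterarrivalLaw K α cK) (hα : α ≠ 1) {P : Measure (ℕ → ℝ)}
    (hP : IsBinaryEnvironment P) (hI : InfiniteDisorder P) {β : ℝ} (hβ : 0 ≤ β) :
    criticalPoint K P β = ((-β : ℝ) : EReal) := by
  obtain ⟨u₁, hu₁, hpos⟩ := hK.freeEnergy_pos hα hP hI hβ
  refine le_antisymm ?_ (le_iInf₂ fun h hF => ?_)
  · have h1 : ∀ u : ℝ, 0 < u → u ≤ u₁ → criticalPoint K P β ≤ ((-β + u : ℝ) : EReal) :=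
      fun u hu hu1 => iInf₂_le (-β + u) (hpos u hu hu1)
    have h2 : Tendsto (fun u : ℝ => ((-β + u : ℝ) : EReal)) (𝓝[>] 0) (𝓝 ((-β + 0 : ℝ) : EReal)) :=
      ((continuous_coe_real_ereal.comp (continuous_const.add continuous_id)).tendsto 0).mono_left
        nhdsWithin_le_nhds
    rw [add_zero] at h2
    refine ge_of_tendsto h2 ?_
    filter_upwards [Ioc_mem_nhdsGT hu₁] with u hu
    exact h1 u hu.1 hu.2
  · by_contra hlt
    have h1 : h ≤ -β := by
      have := (not_le.1 hlt).le
      exact_mod_cast this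
    exact absurd hF (not_lt.2 (hP.freeEnergy_nonpos K hβ h1))

end Pinning

end

theorem theorem1p6 (K : PMF ℕ) (α cK : ℝ) (hK : Pinning.IsInterarrivalLaw K α cK) (hα : α ≠ 1)
    (P : Measure (ℕ → ℝ)) (hP : Pinning.IsBinaryEnvironment P) :
    (∀ β : ℝ, 0 < β → Pinning.criticalPoint K P β = ((-β : ℝ) : EReal) →
      (fun u : ℝ => Pinning.freeEnergy K P β (-β + u)) =o[𝓝[>] 0]
        fun u : ℝ => Pinning.freeEnergy K P 0 u) ∧
    (Pinning.InfiniteDisorder P → ∀ β : ℝ, 0 < β →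
      Pinning.criticalPoint K P β = ((-β : ℝ) : EReal) ∧
      (fun u : ℝ => Pinning.freeEnergy K P β (-β + u)) =o[𝓝[>] 0]
        fun u : ℝ => Pinning.freeEnergy K P 0 u) :=
  ⟨fun _ hβ _ => hK.freeEnergy_isLittleO hα hP hβ,
    fun hI _ hβ => ⟨hK.criticalPoint_eq hα hP hI hβ.le, hK.freeEnergy_isLittleO hα hP hβ⟩⟩
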